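/- Let $\mathbb F=\mathbb C(q)$, $[n]=\dfrac{q^n-q^{-n}}{q-q^{-1}}\in\mathbb F$ and $d=[2]=q+q^{-1}$. In the generic Temperley–Lieb category $\mathrm{TL}$ the objects are the non-negative integers. $\mathrm{Hom}(m,n)$ is the $\mathbb F$-linear span of the simple Temperley–Lieb diagrams from $m$ to $n$ points (planar isotopy classes of disjoint arcs in the unit square which join in pairs the $m$ marked points on the bottom edge and the $n$ marked points on the top edge, together with finitely many loops), modulo the relation that a diagram with a loop equals $d$ times the diagram without that loop. The composition $gf=g\circ f$ stacks $g$ on top of $f$, the tensor product $f\otimes g$ puts $f$ to the left of $g$, and $\mathrm{id}_n$ is the diagram of $n$ through-strings. For $1\le i<n$ let $\cup_i=\cup_{i,n}\colon n-2\to n$ be the diagram with a cup joining the $i$-th and $(i+1)$-th top points, all other points being joined by through-strings, and let $\cap_i=\cap_{i,n}\colon n\to n-2$ be its reflection in the horizontal. **Theorem (Jones–Wenzl idempotents).** For every $n\ge 0$ we have $[n+1]\ne 0$ in $\mathbb F$, so that $$p_0=\mathrm{id}_0,\qquad p_1=\mathrm{id}_1,\qquad p_{n+1}=p_n\otimes\mathrm{id}_1-\frac{[n]}{[n+1]}\,(p_n\otimes\mathrm{id}_1)\,\cup_{n}\cap_{n}\,(p_n\otimes\mathrm{id}_1)\quad(n\ge1),$$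 with $\cup_n=\cup_{n,n+1}$ and $\cap_n=\cap_{n,n+1}$, are well-defined elements $p_n\in\mathrm{Hom}(n,n)$. For every $n\ge0$, $p_n$ is the unique endomorphism $n\to n$ in $\mathrm{TL}$ with the following properties: 1. $p_n$ is nonzero and $p_n=\mathrm{id}_n+m$, where $m$ is an $\mathbb F$-linear combination of non-identity diagrams $n\to n$ (diagrams whose arcs are not just the $n$ through-strings of $\mathrm{id}_n$); 2. $\cap_i\,p_n=0$ and $p_n\,\cup_i=0$ for $i=1,\dots,n-1$; 3. $p_n^2=p_n$. -/

import Mathlib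

/-!
# The generic Temperley-Lieb category and the Jones-Wenzl elements

Points on the boundary of the unit square are listed linearly, walking clockwise along the boundary
from the bottom right corner: first the `m` bottom points from right to left, then the `n` top
points from left to right. The `j`-th bottom point (`1 ≤ j ≤ m`, counted from the left) gets the
position `m - j`, the `j`-th top point (`1 ≤ j ≤ n`, counted from the left) the position
`m + j - 1`. The arcs of a Temperley-Lieb diagram are determined up to planar isotopy by the
noncrossing perfect matching of the positions `0, …, m + n - 1` which they induce.
-/

namespace TemperleyLieb

/-! ### Scalars -/

/-- The ground field `ℂ(q)`. -/
abbrev 𝔽 : Type := RatFunc ℂ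

/-- The formal parameter `q`. -/
noncomputable def q : 𝔽 := RatFunc.X

/-- The quantum integer `[n] = (q ^ n - q ^ (-n)) / (q - q ^ (-1))`. -/
noncomputable def quantumInt (n : ℕ) : 𝔽 := (q ^ (n : ℤ) - q ^ (-(n : ℤ))) / (q - q⁻¹)

/-- The value `d = [2]` of a loop. -/
noncomputable def loopValue : 𝔽 := quantumInt 2

/-! ### Noncrossing perfect matchings of `0, …, N - 1` -/

/-- `p` is a noncrossing perfect matching of the positions `0, …, N - 1`: a fixed-point-free
involution of these positions (extended by the identity to all of `ℕ`) without two arcs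
`{x, p x}`, `{y, p y}` such that `x < y < p x < p y`. -/
structure IsNCMatching (N : ℕ) (p : ℕ → ℕ) : Prop where
  invol : ∀ x, p (p x) = x
  ne_self : ∀ x, x < N → p x ≠ x
  outside : ∀ x, N ≤ x → p x = x
  noncrossing : ∀ x y, x < y → y < p x → ¬ p x < p y

theorem IsNCMatching.lt {N : ℕ} {p : ℕ → ℕ} (h : IsNCMatching N p) {x : ℕ} (hx : x < N) :
    p x < N := by
  by_contra hc
  have h1 := h.outside (p x) (by omega)
  rw [h.invol] at h1
  exact h.ne_self x hx h1.symm

/-- Relabelling of the positions after the positions `i` and `i + 1` have been deleted. -/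
def unskip (i y : ℕ) : ℕ := if y < i then y else y - 2

/-- Inverse of the relabelling `unskip`. -/
def skip (i x : ℕ) : ℕ := if x < i then x else x + 2

/-- Join the two ends at the adjacent positions `i`, `i + 1` and delete these positions: the
partners of `i` and of `i + 1` become partners of each other, all other arcs stay. If `i` and
`i + 1` are partners then joining them closes a loop, and the arc `{i, i + 1}` just disappears. -/
def contract (i : ℕ) (p : ℕ → ℕ) (x : ℕ) : ℕ :=
  unskip i (if p (skip i x) = i then p (i + 1)
    else if p (skip i x) = i + 1 then p i
    else p (skip i x))

/-- Join, for `j = n - 1, …, 0`, the ends at the positions `a + j` and `a + 2 * n - 1 - j`.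
The two ends at each stage are adjacent, at `a + j` and `a + j + 1`. -/
def glue (a : ℕ) : ℕ → (ℕ → ℕ) → (ℕ → ℕ)
  | 0, p => p
  | n + 1, p => glue a n (contract (a + n) p)

/-- The number of loops closed in the course of `glue a n p`. -/
def glueLoops (a : ℕ) : ℕ → (ℕ → ℕ) → ℕ
  | 0, _ => 0
  | n + 1, p => (if p (a + n) = a + n + 1 then 1 else 0) + glueLoops a n (contract (a + n) p)

theorem IsNCMatching.contract {N i : ℕ} {p : ℕ → ℕ} (h : IsNCMatching (N + 2) p) (hi : i ≤ N) :
    IsNCMatching N (contract i p) := by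
  have hinv := h.invol
  have hne := h.ne_self
  have hout := h.outside
  have hnc := h.noncrossing
  have hlt := @IsNCMatching.lt _ _ h
  have skip_ne : ∀ x, skip i x ≠ i ∧ skip i x ≠ i + 1 := by
    intro x; simp only [skip]; grind
  have unskip_skip : ∀ x, unskip i (skip i x) = x := by
    intro x; simp only [skip, unskip]; grind
  have skip_lt : ∀ x y, skip i x < skip i y ↔ x < y := by
    intro x y; simp only [skip]; grind
  have skip_lt' : ∀ x, skip i x < N + 2 ↔ x < N := by
    intro x; simp only [skip]; grind
  have hi1 := hne i (by omega)
  have hi2 := hne (i + 1) (by omega)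
  have key : ∀ x, skip i (TemperleyLieb.contract i p x) =
      if p (skip i x) = i then p (i + 1)
      else if p (skip i x) = i + 1 then p i
      else p (skip i x) := by
    intro x
    have hs : ∀ z, z ≠ i → z ≠ i + 1 → skip i (unskip i z) = z := by
      intro z _ _; simp only [skip, unskip]; grind
    have nx := skip_ne x
    have e1 := hinv (skip i x)
    have e2 := hinv i
    have e3 := hinv (i + 1)
    refine hs _ ?_ ?_ <;> clear hs hinv hne hout hnc hlt skip_ne unskip_skip skip_lt skip_lt' h <;>
      grind
  have inj : ∀ x y, skip i x = skip i y → x = y := fun x y hxy => by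
    rw [← unskip_skip x, hxy, unskip_skip]
  refine ⟨fun x => inj _ _ ?_, fun x hx hc => ?_, fun x hx => inj _ _ ?_, fun x y h1 h2 h3 => ?_⟩
  · have nx := skip_ne x
    rw [key, key]
    have e1 := hinv (skip i x)
    have e2 := hinv i
    have e3 := hinv (i + 1)
    clear hinv hne hout hnc hlt skip_ne unskip_skip skip_lt skip_lt' h inj key
    grind
  · have nx := skip_ne x
    have k1 := key x
    rw [hc] at k1
    have e0 := hne (skip i x) ((skip_lt' x).2 hx)
    have e1 := hinv (skip i x)
    have e2 := hinv i
    have e3 := hinv (i + 1)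
    clear hinv hne hout hnc hlt skip_ne unskip_skip skip_lt skip_lt' h inj key hc
    grind
  · have nx := skip_ne x
    have e0 := (skip_lt' x).not.2 (by omega)
    have e1 := hout (skip i x) (by omega)
    rw [key, e1, if_neg nx.1, if_neg nx.2]
  · rw [← skip_lt] at h1 h2 h3
    rw [key] at h2 h3
    rw [key] at h3
    have nx := skip_ne x
    have ny := skip_ne y
    generalize skip i x = x at *
    generalize skip i y = y at *
    have inv1 : p x = i → p i = x := fun e => by rw [← e, hinv]
    have inv2 : p x = i + 1 → p (i + 1) = x := fun e => by rw [← e, hinv]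
    have inv3 : p y = i → p i = y := fun e => by rw [← e, hinv]
    have inv4 : p y = i + 1 → p (i + 1) = y := fun e => by rw [← e, hinv]
    have c1 := hnc x y
    have c2 := hnc x i
    have c3 := hnc x (i + 1)
    have c4 := hnc i y
    have c5 := hnc (i + 1) y
    have c6 := hnc (i + 1) x
    have c7 := hnc i (i + 1)
    have c8 := hnc x (p (i + 1))
    have c9 := hnc y (p i)
    rw [hinv] at c8 c9
    obtain ⟨nx1, nx2⟩ := nx
    obtain ⟨ny1, ny2⟩ := ny
    clear hnc hout hlt hne key skip_lt skip_lt' inj unskip_skip skip_ne h hinv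
    by_cases hx1 : p x = i
    · rw [if_pos hx1] at h2 h3
      have := inv1 hx1
      by_cases hy1 : p y = i
      · have := inv3 hy1
        omega
      · by_cases hy2 : p y = i + 1
        · have := inv4 hy2
          omega
        · rw [if_neg hy1, if_neg hy2] at h3
          clear c2 c3 c4 c6 c9 inv1 inv2 inv3 inv4
          generalize p (i + 1) = z at *
          generalize p y = w at *
          omega
    · rw [if_neg hx1] at h2 h3
      by_cases hx2 : p x = i + 1
      · rw [if_pos hx2] at h2 h3
        have := inv2 hx2
        by_cases hy1 : p y = i
        · have := inv3 hy1
          omega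
        · rw [if_neg hy1] at h3
          by_cases hy2 : p y = i + 1
          · have := inv4 hy2
            omega
          · rw [if_neg hy2] at h3
            clear c2 c3 c5 c6 c8 inv1 inv2 inv3 inv4
            omega
      · rw [if_neg hx2] at h2 h3
        by_cases hy1 : p y = i
        · rw [if_pos hy1] at h3
          have := inv3 hy1
          clear c4 c5 c6 c8 c9 inv1 inv2 inv3 inv4
          omega
        · rw [if_neg hy1] at h3
          by_cases hy2 : p y = i + 1
          · rw [if_pos hy2] at h3
            have := inv4 hy2
            clear c4 c5 c8 c9 inv1 inv2 inv3 inv4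
            omega
          · rw [if_neg hy2] at h3
            exact c1 h1 h2 h3

theorem IsNCMatching.glue {a b : ℕ} (n : ℕ) {p : ℕ → ℕ} (h : IsNCMatching (a + 2 * n + b) p) :
    IsNCMatching (a + b) (glue a n p) := by
  induction n generalizing p with
  | zero => simpa [TemperleyLieb.glue] using h
  | succ n ih =>
    have e : a + 2 * (n + 1) + b = (a + 2 * n + b) + 2 := by ring
    rw [e] at h
    exact ih (h.contract (by omega))

/-- Put `p'` to the right of a matching `p` of `0, …, N - 1`. -/
def juxtapose (N : ℕ) (p p' : ℕ → ℕ) (x : ℕ) : ℕ :=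
  if x < N then p x else p' (x - N) + N

theorem IsNCMatching.juxtapose {N N' : ℕ} {p p' : ℕ → ℕ} (h : IsNCMatching N p)
    (h' : IsNCMatching N' p') : IsNCMatching (N + N') (juxtapose N p p') := by
  obtain ⟨a1, a2, a3, a4⟩ := id h
  obtain ⟨b1, b2, b3, b4⟩ := id h'
  have hlt := @IsNCMatching.lt _ _ h
  unfold TemperleyLieb.juxtapose
  constructor
  · intro x
    have := b1 (x - N)
    grind
  · intro x hx
    have := b2 (x - N)
    grind
  · intro x hx
    have := b3 (x - N)
    grind
  · intro x y
    have := a4 x y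
    have := b4 (x - N) (y - N)
    grind

/-- Insert a matching `p` of `0, …, N - 1` into a matching `p'` just before the position `a`. -/
def insertAt (a N : ℕ) (p p' : ℕ → ℕ) (x : ℕ) : ℕ :=
  if a ≤ x ∧ x < a + N then p (x - a) + a
  else
    let y := p' (if x < a then x else x - N)
    if y < a then y else y + N

theorem IsNCMatching.insertAt {a N N' : ℕ} {p p' : ℕ → ℕ} (h : IsNCMatching N p)
    (h' : IsNCMatching N' p') (ha : a ≤ N') : IsNCMatching (N + N') (insertAt a N p p') := by
  obtain ⟨a1, a2, a3, a4⟩ := id h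
  obtain ⟨b1, b2, b3, b4⟩ := id h'
  have hlt : ∀ x, x < N → p x < N := fun _ => h.lt
  generalize hs : (fun y : ℕ => if y < a then y else y + N) = s
  have s_eq : ∀ y, s y = if y < a then y else y + N := fun y => by rw [← hs]
  have s_out : ∀ y, s y < a ∨ a + N ≤ s y := fun y => by rw [s_eq]; split_ifs <;> omega
  have s_lt : ∀ y z, s y < s z ↔ y < z := fun y z => by
    rw [s_eq, s_eq]; split_ifs <;> omega
  have s_lt' : ∀ y, s y < N + N' ↔ y < N' := fun y => by
    rw [s_eq]; split_ifs <;> omega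
  have mid : ∀ x, x < N → TemperleyLieb.insertAt a N p p' (x + a) = p x + a := fun x hx => by
    unfold TemperleyLieb.insertAt
    rw [if_pos (by omega), Nat.add_sub_cancel]
  have out : ∀ y, TemperleyLieb.insertAt a N p p' (s y) = s (p' y) := fun y => by
    have e : (if s y < a then s y else s y - N) = y := by
      rw [s_eq]; split_ifs <;> omega
    have := s_out y
    unfold TemperleyLieb.insertAt
    rw [if_neg (by omega), e, s_eq]
  have cover : ∀ z, (∃ x, x < N ∧ z = x + a) ∨ ∃ y, z = s y := fun z => by
    by_cases h1 : z < a
    · exact Or.inr ⟨z, by rw [s_eq, if_pos h1]⟩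
    · by_cases h2 : z < a + N
      · exact Or.inl ⟨z - a, by omega, by omega⟩
      · exact Or.inr ⟨z - N, by rw [s_eq, if_neg (by omega)]; omega⟩
  refine ⟨fun x => ?_, fun x hx' => ?_, fun x hx => ?_, fun x y => ?_⟩
  · obtain ⟨x, hx, rfl⟩ | ⟨x, rfl⟩ := cover x
    · rw [mid x hx, mid _ (hlt x hx), a1]
    · rw [out, out, b1]
  · obtain ⟨x, hx, rfl⟩ | ⟨x, rfl⟩ := cover x
    · have := a2 x hx
      rw [mid x hx]; omega
    · have h1 := b2 x ((s_lt' x).1 hx')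
      have h2 := s_lt (p' x) x
      have h3 := s_lt x (p' x)
      rw [out]; omega
  · obtain ⟨x, h1, rfl⟩ | ⟨x, rfl⟩ := cover x
    · omega
    · rw [out, b3 x (by have := s_lt' x; omega)]
  · obtain ⟨x, hx, rfl⟩ | ⟨x, rfl⟩ := cover x <;> obtain ⟨y, hy, rfl⟩ | ⟨y, rfl⟩ := cover y
    · have := a4 x y
      rw [mid x hx, mid y hy]; omega
    · have := hlt x hx
      have := s_out y
      rw [mid x hx]; omega
    · have := hlt y hy
      have := s_out (p' x)
      rw [out, mid y hy]; omega
    · rw [out, out, s_lt, s_lt, s_lt]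
      exact b4 x y

/-! ### Simple Temperley-Lieb diagrams -/

/-- A simple Temperley-Lieb diagram from `m` (bottom) to `n` (top) points: its arcs, and the number
of its loops. (The place of a loop among the arcs is not recorded: it plays no role for
the operations below, and any two places are identified by the relation `dEquiv`.) -/
@[ext]
structure SimpleDiagram (m n : ℕ) where
  partner : ℕ → ℕ
  isNCMatching : IsNCMatching (m + n) partner
  loops : ℕ

/-- The position of the `j`-th bottom point from the left, `1 ≤ j ≤ m`. -/
def bot (m j : ℕ) : ℕ := m - j

/-- The position of the `j`-th top point from the left, `1 ≤ j`. -/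
def top (m j : ℕ) : ℕ := m + j - 1

namespace SimpleDiagram

/-- Add a loop to a diagram. -/
def addLoop {m n : ℕ} (f : SimpleDiagram m n) : SimpleDiagram m n where
  partner := f.partner
  isNCMatching := f.isNCMatching
  loops := f.loops + 1

/-- The composition `g ∘ f`, the diagram `g` stacked on top of `f`. The list of the positions of `f`
is followed by that of `g`, and the `j`-th top point of `f`, at `m + j - 1`, is joined with the
`j`-th bottom point of `g`, at `(m + n) + (n - j)`, for `j = n, …, 1`. -/
def comp {m n k : ℕ} (g : SimpleDiagram n k) (f : SimpleDiagram m n) : SimpleDiagram m k where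
  partner := glue m n (juxtapose (m + n) f.partner g.partner)
  isNCMatching := by
    have h := f.isNCMatching.juxtapose g.isNCMatching
    have e : m + n + (n + k) = m + 2 * n + k := by ring
    rw [e] at h
    exact h.glue n
  loops := f.loops + g.loops + glueLoops m n (juxtapose (m + n) f.partner g.partner)

/-- The juxtaposition `f ⊗ g`, with `f` on the left of `g`: along the boundary come the bottom
points of `g`, then all points of `f`, then the top points of `g`. -/
def tensor {m n m' n' : ℕ} (f : SimpleDiagram m n) (g : SimpleDiagram m' n') :
    SimpleDiagram (m + m') (n + n') where
  partner := insertAt m' (m + n) f.partner g.partner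
  isNCMatching := by
    have h := f.isNCMatching.insertAt g.isNCMatching (a := m') (by omega)
    have e : m + n + (m' + n') = m + m' + (n + n') := by ring
    rwa [e] at h
  loops := f.loops + g.loops

/-- Reflection in the horizontal middle line, exchanging top and bottom. -/
def reflect {m n : ℕ} (f : SimpleDiagram m n) : SimpleDiagram n m where
  partner x := if x < m + n then m + n - 1 - f.partner (m + n - 1 - x) else x
  isNCMatching := by
    obtain ⟨a1, a2, a3, a4⟩ := f.isNCMatching
    have hlt : ∀ x, x < m + n → f.partner x < m + n := fun _ => f.isNCMatching.lt
    constructor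
    · intro x
      have := hlt (m + n - 1 - x)
      have := a1 (m + n - 1 - x)
      grind
    · intro x hx
      have := a2 (m + n - 1 - x)
      have := hlt (m + n - 1 - x)
      grind
    · intro x hx
      grind
    · intro x y
      have := hlt (m + n - 1 - x)
      have := hlt (m + n - 1 - y)
      have := a1 (m + n - 1 - x)
      have := a1 (m + n - 1 - y)
      have := a4 (f.partner (m + n - 1 - y)) (f.partner (m + n - 1 - x))
      grind
  loops := f.loops

/-- The diagram `id_n` with `n` through-strings. -/
def id (n : ℕ) : SimpleDiagram n n where
  partner x := if x < 2 * n then 2 * n - 1 - x else x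
  isNCMatching := by
    constructor <;> intros <;> grind
  loops := 0

/-- The cup `∪_{i,n} : n - 2 → n` for `1 ≤ i < n`: the `i`-th and the `i + 1`-th top points are
joined, the other points are joined by through-strings from left to right. See `cup_left`,
`cup_right`, `cup_cup` below. -/
def cup (n i : ℕ) (hi : 1 ≤ i) (hn : i < n) : SimpleDiagram (n - 2) n where
  partner x :=
    if x < n - 1 - i then 2 * n - 3 - x
    else if x < n + i - 3 then 2 * n - 5 - x
    else if x = n + i - 3 then n + i - 2
    else if x = n + i - 2 then n + i - 3
    else if x < 2 * n - 2 then 2 * n - 3 - x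
    else x
  isNCMatching := by
    constructor <;> intros <;> grind
  loops := 0

/-- The cap `∩_{i,n} : n → n - 2`, the reflection of the cup `∪_{i,n}`. -/
def cap (n i : ℕ) (hi : 1 ≤ i) (hn : i < n) : SimpleDiagram n (n - 2) := (cup n i hi hn).reflect

theorem id_through (n j : ℕ) (hj : 1 ≤ j) (hn : j ≤ n) :
    (id n).partner (bot n j) = top n j := by
  simp only [id, bot, top]; grind

theorem cup_left (n i : ℕ) (hi : 1 ≤ i) (hn : i < n) (j : ℕ) (hj : 1 ≤ j) (hji : j < i) :
    (cup n i hi hn).partner (bot (n - 2) j) = top (n - 2) j := by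
  simp only [cup, bot, top]; grind

theorem cup_right (n i : ℕ) (hi : 1 ≤ i) (hn : i < n) (j : ℕ) (hij : i ≤ j) (hj : j ≤ n - 2) :
    (cup n i hi hn).partner (bot (n - 2) j) = top (n - 2) (j + 2) := by
  simp only [cup, bot, top]; grind

theorem cup_cup (n i : ℕ) (hi : 1 ≤ i) (hn : i < n) :
    (cup n i hi hn).partner (top (n - 2) i) = top (n - 2) (i + 1) := by
  simp only [cup, top]; grind

theorem addLoop_comp {m n k : ℕ} (g : SimpleDiagram n k) (f : SimpleDiagram m n) :
    g.addLoop.comp f = (g.comp f).addLoop := by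
  ext x
  · rfl
  · simp only [comp, addLoop]; omega

theorem comp_addLoop {m n k : ℕ} (g : SimpleDiagram n k) (f : SimpleDiagram m n) :
    g.comp f.addLoop = (g.comp f).addLoop := by
  ext x
  · rfl
  · simp only [comp, addLoop]; omega

theorem addLoop_tensor {m n m' n' : ℕ} (f : SimpleDiagram m n) (g : SimpleDiagram m' n') :
    f.addLoop.tensor g = (f.tensor g).addLoop := by
  ext x
  · rfl
  · simp only [tensor, addLoop]; omega

theorem tensor_addLoop {m n m' n' : ℕ} (f : SimpleDiagram m n) (g : SimpleDiagram m' n') :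
    f.tensor g.addLoop = (f.tensor g).addLoop := by
  ext x
  · rfl
  · simp only [tensor, addLoop]; omega

end SimpleDiagram

/-! ### The generic Temperley-Lieb category -/

/-- The `d`-equivalence relation: a diagram with a loop is `d` times the diagram without it. -/
noncomputable def dEquiv (m n : ℕ) : Submodule 𝔽 (SimpleDiagram m n →₀ 𝔽) :=
  Submodule.span 𝔽 (Set.range fun f : SimpleDiagram m n =>
    Finsupp.single f.addLoop (1 : 𝔽) - loopValue • Finsupp.single f (1 : 𝔽))

/-- The morphisms `m → n` of the generic Temperley-Lieb category: linear combinations of simple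
diagrams modulo `d`-equivalence. -/
abbrev Hom (m n : ℕ) : Type := (SimpleDiagram m n →₀ 𝔽) ⧸ dEquiv m n

/-- The morphism given by a simple diagram. -/
noncomputable def mk {m n : ℕ} (f : SimpleDiagram m n) : Hom m n :=
  (dEquiv m n).mkQ (Finsupp.single f 1)

theorem mk_addLoop {m n : ℕ} (f : SimpleDiagram m n) : mk f.addLoop = loopValue • mk f := by
  rw [mk, mk, ← map_smul, ← sub_eq_zero, ← map_sub, Submodule.mkQ_apply,
    Submodule.Quotient.mk_eq_zero]
  exact Submodule.subset_span ⟨f, rfl⟩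

/-- The linear extension to `Hom m n` of a map on simple diagrams that respects
`d`-equivalence. -/
noncomputable def lift {m n : ℕ} {V : Type} [AddCommGroup V] [Module 𝔽 V]
    (φ : SimpleDiagram m n → V) (hφ : ∀ f, φ f.addLoop = loopValue • φ f) : Hom m n →ₗ[𝔽] V :=
  (dEquiv m n).liftQ (Finsupp.linearCombination 𝔽 φ) (by
    rw [dEquiv, Submodule.span_le]
    rintro _ ⟨f, rfl⟩
    simp [hφ])

@[simp]
theorem lift_mk {m n : ℕ} {V : Type} [AddCommGroup V] [Module 𝔽 V]
    (φ : SimpleDiagram m n → V) (hφ : ∀ f, φ f.addLoop = loopValue • φ f)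
    (f : SimpleDiagram m n) : lift φ hφ (mk f) = φ f := by
  simp [lift, mk]

theorem hom_ext {m n : ℕ} {V : Type} [AddCommGroup V] [Module 𝔽 V] {φ ψ : Hom m n →ₗ[𝔽] V}
    (h : ∀ f, φ (mk f) = ψ (mk f)) : φ = ψ := by
  refine Submodule.linearMap_qext _ (Finsupp.lhom_ext' fun f => LinearMap.ext_ring ?_)
  exact h f

/-- The bilinear composition `(g, f) ↦ g ∘ f` of morphisms. -/
noncomputable def compBilin (m n k : ℕ) : Hom n k →ₗ[𝔽] Hom m n →ₗ[𝔽] Hom m k :=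
  lift (fun g => lift (fun f => mk (g.comp f)) fun f => by
      rw [SimpleDiagram.comp_addLoop, mk_addLoop])
    fun g => hom_ext fun f => by
      simp [SimpleDiagram.addLoop_comp, mk_addLoop]

/-- The composition `g ∘ f` of `f : m → n` and `g : n → k`. -/
noncomputable def comp {m n k : ℕ} (g : Hom n k) (f : Hom m n) : Hom m k := compBilin m n k g f

theorem comp_mk {m n k : ℕ} (g : SimpleDiagram n k) (f : SimpleDiagram m n) :
    comp (mk g) (mk f) = mk (g.comp f) := by
  simp [comp, compBilin]

/-- The bilinear tensor product `(f, g) ↦ f ⊗ g` of morphisms. -/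
noncomputable def tensorBilin (m n m' n' : ℕ) :
    Hom m n →ₗ[𝔽] Hom m' n' →ₗ[𝔽] Hom (m + m') (n + n') :=
  lift (fun f => lift (fun g => mk (f.tensor g)) fun g => by
      rw [SimpleDiagram.tensor_addLoop, mk_addLoop])
    fun f => hom_ext fun g => by
      simp [SimpleDiagram.addLoop_tensor, mk_addLoop]

/-- The tensor product `f ⊗ g`, with `f` on the left of `g`. -/
noncomputable def tensor {m n m' n' : ℕ} (f : Hom m n) (g : Hom m' n') :
    Hom (m + m') (n + n') := tensorBilin m n m' n' f g

theorem tensor_mk {m n m' n' : ℕ} (f : SimpleDiagram m n) (g : SimpleDiagram m' n') :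
    tensor (mk f) (mk g) = mk (f.tensor g) := by
  simp [tensor, tensorBilin]

/-- The identity morphism of `n`. -/
noncomputable def id (n : ℕ) : Hom n n := mk (SimpleDiagram.id n)

/-- The morphism `∪_i : n - 2 → n`, for `1 ≤ i < n`. -/
noncomputable def cup (n i : ℕ) (hi : 1 ≤ i) (hn : i < n) : Hom (n - 2) n :=
  mk (SimpleDiagram.cup n i hi hn)

/-- The morphism `∩_i : n → n - 2`, for `1 ≤ i < n`. -/
noncomputable def cap (n i : ℕ) (hi : 1 ≤ i) (hn : i < n) : Hom n (n - 2) :=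
  mk (SimpleDiagram.cap n i hi hn)

/-! ### Jones-Wenzl elements -/

/-- The elements `p_n` of `TL_n = Hom n n`: `p_0` and `p_1` are identities and
`p_{n+1} = p_n ⊗ id_1 - ([n] / [n+1]) (p_n ⊗ id_1) ∘ ∪_n ∘ ∩_n ∘ (p_n ⊗ id_1)` for `n ≥ 1`. -/
noncomputable def jonesWenzl : (n : ℕ) → Hom n n
  | 0 => id 0
  | 1 => id 1
  | n + 2 =>
    let P : Hom (n + 1 + 1) (n + 1 + 1) := tensor (jonesWenzl (n + 1)) (id 1)
    P - (quantumInt (n + 1) / quantumInt (n + 2)) •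
      comp P (comp (cup (n + 2) (n + 1) (by omega) (by omega))
        (comp (cap (n + 2) (n + 1) (by omega) (by omega)) P))

/-- The linear combinations of non-identity diagrams `n → n`, i.e. of diagrams whose arcs are
not just the `n` through-strings of the identity. (A diagram consisting of `id_n` and some loops is
not admitted here: it is a multiple of the identity.) -/
noncomputable def nonIdentitySpan (n : ℕ) : Submodule 𝔽 (Hom n n) :=
  Submodule.span 𝔽
    {x | ∃ f : SimpleDiagram n n, f.partner ≠ (SimpleDiagram.id n).partner ∧ x = mk f}

/-- The characteristic properties of the `n`-th Jones-Wenzl idempotent. -/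
structure IsJonesWenzl (n : ℕ) (p : Hom n n) : Prop where
  ne_zero : p ≠ 0
  eq_id_add : ∃ m ∈ nonIdentitySpan n, p = id n + m
  cap_comp : ∀ (i : ℕ) (hi : 1 ≤ i) (hn : i < n), comp (cap n i hi hn) p = 0
  comp_cup : ∀ (i : ℕ) (hi : 1 ≤ i) (hn : i < n), comp p (cup n i hi hn) = 0
  idem : comp p p = p

end TemperleyLieb

namespace TemperleyLieb

/-! Two facts carry the theorem.

(1) A diagram `n → n` whose arcs are not those of the identity joins two neighbouring top points
(`SimpleDiagram.exists_top_arc`): a shortest arc between top points is of this kind, and if no arc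
joins two top points, noncrossing leaves only the through-strings. As `d` is invertible, such a
diagram factors as `∪_i x` and, by reflection, as `x ∩_i` (`eq_cup_comp_of_ne_id`,
`eq_comp_cap_of_ne_id`). If `p = id + m` is killed by all caps, then `m p = 0`, so `p² = p`. If `p`
and `p'` both have the characteristic properties, `p p'` equals both of them, which is uniqueness.
The coefficient of the identity (`idCoeff`) shows `p ≠ 0`.

(2) The caps kill `p_n`, by induction. A cap not touching the last strand already kills `p_n ⊗
id_1`. For the last cap one needs the partial trace `∩_{n+1} (p_{n+1} ⊗ id_1) ∪_{n+1} =
([n+2]/[n+1]) p_n` (`partialTrace_jonesWenzl`), a consequence of the recursion, the snake identities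
and `d [n+1] = [n+2] + [n]`. The coefficient of the recursion is the inverse of this scalar, so the
two terms cancel. The cups follow since `p_n` equals its reflection.

The longer half shows that the combinatorial diagrams behave like pictures. Composition is an
iterated joining of adjacent ends, and joinings at disjoint places commute, loops included
(`contract_comm`, `contract_comm_loops`). This yields associativity, the unit laws, functoriality of
`- ⊗ id_1`, and the description of cups and caps as inserting an arc and joining two ends. -/

/-! ### Contractions at disjoint places commute -/

theorem skip_ne (i x : ℕ) : skip i x ≠ i ∧ skip i x ≠ i + 1 := by
  simp only [skip]; grind

theorem skip_injective (i : ℕ) : Function.Injective (skip i) := by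
  intro x y; simp only [skip]; grind

theorem skip_unskip {i z : ℕ} (h : z ≠ i) (h' : z ≠ i + 1) : skip i (unskip i z) = z := by
  simp only [skip, unskip]; grind

theorem skip_comm {i j : ℕ} (h : i ≤ j) (x : ℕ) :
    skip (j + 2) (skip i x) = skip i (skip j x) := by
  simp only [skip]; grind

theorem skip_eq_self {i x : ℕ} (h : x < i) : skip i x = x := by
  simp [skip, h]

theorem skip_eq_add_two {i x : ℕ} (h : i ≤ x) : skip i x = x + 2 := by
  simp [skip, Nat.not_lt.2 h]

theorem skip_contract {i : ℕ} {p : ℕ → ℕ} (hinv : ∀ x, p (p x) = x) (h1 : p i ≠ i)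
    (h2 : p (i + 1) ≠ i + 1) (x : ℕ) :
    skip i (contract i p x) =
      if p (skip i x) = i then p (i + 1)
      else if p (skip i x) = i + 1 then p i
      else p (skip i x) := by
  have nx := skip_ne i x
  have e1 := hinv (skip i x)
  have e2 := hinv i
  have e3 := hinv (i + 1)
  refine skip_unskip ?_ ?_ <;> clear hinv <;> grind

/-- Both sides join the same two pairs of ends of `p`, at `i, i + 1` and at `j + 2, j + 3`. The
later pair is called `j` once the earlier one has been deleted. -/
theorem contract_comm {N i j : ℕ} {p : ℕ → ℕ} (h : IsNCMatching (N + 4) p) (hij : i ≤ j)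
    (hj : j ≤ N) : contract i (contract (j + 2) p) = contract j (contract i p) := by
  have h1 : IsNCMatching (N + 2) (contract (j + 2) p) := h.contract (by omega)
  have h2 : IsNCMatching (N + 2) (contract i p) := h.contract (by omega)
  have k1 := skip_contract h1.invol (h1.ne_self i (by omega)) (h1.ne_self (i + 1) (by omega))
  have k2 := skip_contract h2.invol (h2.ne_self j (by omega)) (h2.ne_self (j + 1) (by omega))
  have k3 := skip_contract h.invol (h.ne_self (j + 2) (by omega)) (h.ne_self (j + 3) (by omega))
  have k4 := skip_contract h.invol (h.ne_self i (by omega)) (h.ne_self (i + 1) (by omega))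
  have s1 : skip (j + 2) i = i := skip_eq_self (by omega)
  have s2 : skip (j + 2) (i + 1) = i + 1 := skip_eq_self (by omega)
  have s3 : skip i j = j + 2 := skip_eq_add_two hij
  have s4 : skip i (j + 1) = j + 3 := skip_eq_add_two (by omega)
  have iff1 : ∀ y z, y = z ↔ skip (j + 2) y = skip (j + 2) z :=
    fun y z => (skip_injective _).eq_iff.symm
  have iff2 : ∀ y z, y = z ↔ skip i y = skip i z := fun y z => (skip_injective _).eq_iff.symm
  funext x
  -- Going back through both deletions expresses everything in the labels of `p`, where a finite
  -- case distinction on the partners of the four joined ends remains.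
  apply skip_injective j
  apply skip_injective i
  rw [← skip_comm hij, k1, k2]
  simp only [iff1 (contract (j + 2) p _), iff2 (contract i p _), apply_ite (skip (j + 2)),
    apply_ite (skip i), k3, k4, s1, s2, s3, s4, skip_comm hij]
  have a1 := skip_ne i (skip j x)
  have a2 := skip_ne (j + 2) (skip i x)
  rw [skip_comm hij] at a2
  generalize skip i (skip j x) = X at *
  have b0 := h.invol X
  have b1 := h.invol i
  have b2 := h.invol (i + 1)
  have b3 := h.invol (j + 2)
  have b4 := h.invol (j + 3)
  have c1 := h.ne_self i (by omega)
  have c2 := h.ne_self (i + 1) (by omega)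
  have c3 := h.ne_self (j + 2) (by omega)
  have c4 := h.ne_self (j + 3) (by omega)
  clear k1 k2 k3 k4 s1 s2 s3 s4 iff1 iff2 h h1 h2
  grind

/-- The number of loops closed by `contract i p`. -/
def loopAt (i : ℕ) (p : ℕ → ℕ) : ℕ := if p i = i + 1 then 1 else 0

theorem loopAt_congr {i j : ℕ} {p p' : ℕ → ℕ} (h : p i = i + 1 ↔ p' j = j + 1) :
    loopAt i p = loopAt j p' := by
  simp only [loopAt, h]

theorem glue_succ (a n : ℕ) (p : ℕ → ℕ) : glue a (n + 1) p = glue a n (contract (a + n) p) := rfl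

theorem glueLoops_succ (a n : ℕ) (p : ℕ → ℕ) :
    glueLoops a (n + 1) p = loopAt (a + n) p + glueLoops a n (contract (a + n) p) := rfl

/-- A loop running through both joins is closed by whichever contraction comes second, so only the
total is compared. -/
theorem contract_comm_loops {N i j : ℕ} {p : ℕ → ℕ} (h : IsNCMatching (N + 4) p) (hij : i ≤ j)
    (hj : j ≤ N) :
    loopAt (j + 2) p + loopAt i (contract (j + 2) p) = loopAt i p + loopAt j (contract i p) := by
  have k3 := skip_contract h.invol (h.ne_self (j + 2) (by omega)) (h.ne_self (j + 3) (by omega)) i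
  have k4 := skip_contract h.invol (h.ne_self i (by omega)) (h.ne_self (i + 1) (by omega)) j
  have s1 : skip (j + 2) i = i := skip_eq_self (by omega)
  have s2 : skip (j + 2) (i + 1) = i + 1 := skip_eq_self (by omega)
  have s3 : skip i j = j + 2 := skip_eq_add_two hij
  have s4 : skip i (j + 1) = j + 3 := skip_eq_add_two (by omega)
  simp only [loopAt, ← (skip_injective (j + 2)).eq_iff (a := contract (j + 2) p i),
    ← (skip_injective i).eq_iff (a := contract i p j), k3, k4, s1, s2, s3, s4]
  have b1 := h.invol i
  have b2 := h.invol (i + 1)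
  have b3 := h.invol (j + 2)
  have b4 := h.invol (j + 3)
  have c1 := h.ne_self i (by omega)
  have c2 := h.ne_self (i + 1) (by omega)
  have c3 := h.ne_self (j + 2) (by omega)
  have c4 := h.ne_self (j + 3) (by omega)
  clear k3 k4 s1 s2 s3 s4 h
  grind

/-! ### Iterated contractions -/

/-- Since `i ≤ j`, the ends `i, i + 1` lie before the glued block, which starts at `j + 2`. The
contraction therefore passes each stage of the gluing by `contract_comm`. -/
theorem contract_glue (n : ℕ) {N i j : ℕ} {p : ℕ → ℕ}
    (h : IsNCMatching (j + 2 + 2 * n + N) p) (hij : i ≤ j) :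
    contract i (glue (j + 2) n p) = glue j n (contract i p) := by
  induction n generalizing p with
  | zero => rfl
  | succ n ih =>
    have h' : IsNCMatching (j + 2 * n + N + 4) p := by convert h using 1; ring
    have h1 : IsNCMatching (j + 2 * n + N + 2) (contract (j + n + 2) p) := h'.contract (by omega)
    have h2 : IsNCMatching (j + 2 + 2 * n + N) (contract (j + n + 2) p) := by
      convert h1 using 1; ring
    simp only [glue_succ]
    rw [show j + 2 + n = j + n + 2 by ring, ih h2, contract_comm h' (by omega) (by omega)]

theorem contract_glue_loops (n : ℕ) {N i j : ℕ} {p : ℕ → ℕ}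
    (h : IsNCMatching (j + 2 + 2 * n + N) p) (hij : i ≤ j) :
    glueLoops (j + 2) n p + loopAt i (glue (j + 2) n p) =
      loopAt i p + glueLoops j n (contract i p) := by
  induction n generalizing p with
  | zero => simp [glue, glueLoops, add_comm]
  | succ n ih =>
    have h' : IsNCMatching (j + 2 * n + N + 4) p := by convert h using 1; ring
    have h1 : IsNCMatching (j + 2 * n + N + 2) (contract (j + n + 2) p) := h'.contract (by omega)
    have h2 : IsNCMatching (j + 2 + 2 * n + N) (contract (j + n + 2) p) := by
      convert h1 using 1; ring
    simp only [glue_succ, glueLoops_succ]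
    have c := contract_comm_loops h' (show i ≤ j + n by omega) (by omega)
    rw [show j + 2 + n = j + n + 2 by ring, add_assoc, ih h2,
      contract_comm h' (show i ≤ j + n by omega) (by omega)]
    rw [← add_assoc, c, add_assoc]

/-- Two glued blocks separated by `c` untouched positions can be treated in either order. The gap is
`0` for associativity and `i` for composition with the cap at index `i`. -/
theorem glue_glue (n k : ℕ) {a c N : ℕ} {p : ℕ → ℕ}
    (h : IsNCMatching (a + 2 * n + c + 2 * k + N) p) :
    glue a n (glue (a + 2 * n + c) k p) = glue (a + c) k (glue a n p) := by
  induction n generalizing p with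
  | zero => rfl
  | succ n ih =>
    have h' : IsNCMatching (a + 2 * n + c + 2 + 2 * k + N) p := by convert h using 1; ring
    have h1 : IsNCMatching (a + 2 * n + c + 2 * k + N + 2) p := by convert h using 1; ring
    simp only [glue_succ]
    rw [show a + 2 * (n + 1) + c = a + 2 * n + c + 2 by ring, contract_glue k h' (by omega),
      ih (h1.contract (by omega))]

theorem glue_glue_loops (n k : ℕ) {a c N : ℕ} {p : ℕ → ℕ}
    (h : IsNCMatching (a + 2 * n + c + 2 * k + N) p) :
    glueLoops (a + 2 * n + c) k p + glueLoops a n (glue (a + 2 * n + c) k p) =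
      glueLoops a n p + glueLoops (a + c) k (glue a n p) := by
  induction n generalizing p with
  | zero => simp [glue, glueLoops]
  | succ n ih =>
    have h' : IsNCMatching (a + 2 * n + c + 2 + 2 * k + N) p := by convert h using 1; ring
    have h1 : IsNCMatching (a + 2 * n + c + 2 * k + N + 2) p := by convert h using 1; ring
    have e := contract_glue_loops k h' (show a + n ≤ a + 2 * n + c by omega)
    have d := ih (h1.contract (i := a + n) (by omega))
    simp only [glue_succ, glueLoops_succ]
    rw [show a + 2 * (n + 1) + c = a + 2 * n + c + 2 by ring, contract_glue k h' (by omega)]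
    omega

/-! ### Contractions of juxtapositions -/

theorem juxtapose_of_lt {N x : ℕ} (p p' : ℕ → ℕ) (hx : x < N) : juxtapose N p p' x = p x :=
  if_pos hx

theorem juxtapose_add (N : ℕ) (p p' : ℕ → ℕ) (x : ℕ) :
    juxtapose N p p' (N + x) = N + p' x := by
  rw [juxtapose, if_neg (by omega), Nat.add_sub_cancel_left, add_comm]

theorem juxtapose_assoc (N N' : ℕ) {p : ℕ → ℕ} (p' p'' : ℕ → ℕ) :
    juxtapose (N + N') (juxtapose N p p') p'' = juxtapose N p (juxtapose N' p' p'') := by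
  funext x
  simp only [juxtapose, show x - (N + N') = x - N - N' by omega]
  grind

theorem contract_juxtapose_left {N i : ℕ} {p : ℕ → ℕ} (p' : ℕ → ℕ) (h : IsNCMatching (N + 2) p)
    (hi : i ≤ N) : contract i (juxtapose (N + 2) p p') = juxtapose N (contract i p) p' := by
  funext x
  have := h.lt (x := x)
  have := h.lt (x := x + 2)
  have := h.lt (x := i)
  have := h.lt (x := i + 1)
  simp only [contract, juxtapose, skip, unskip]
  grind

theorem contract_juxtapose_right {N M i : ℕ} {p p' : ℕ → ℕ} (hp : ∀ x, x < N → p x < N)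
    (h : IsNCMatching (M + 2) p') (hi : i ≤ M) :
    contract (N + i) (juxtapose N p p') = juxtapose N p (contract i p') := by
  have s : ∀ y, skip (N + i) (N + y) = N + skip i y := fun y => by
    simp only [skip]; split_ifs <;> omega
  have u : ∀ y, unskip (N + i) (N + skip i y) = N + y := fun y => by
    simp only [unskip, skip]; split_ifs <;> omega
  funext x
  by_cases hx : x < N
  · have := hp x hx
    rw [juxtapose_of_lt _ _ hx, contract, skip_eq_self (by omega), juxtapose_of_lt _ _ hx,
      if_neg (by omega), if_neg (by omega), unskip, if_pos (by omega)]
  · obtain ⟨y, rfl⟩ := Nat.exists_eq_add_of_le (Nat.not_lt.1 hx)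
    rw [contract]
    simp only [s, add_assoc, juxtapose_add, add_right_inj, ← apply_ite (N + ·)]
    rw [← skip_contract h.invol (h.ne_self i (by omega)) (h.ne_self (i + 1) (by omega)), u]

theorem glue_juxtapose_left (n : ℕ) {a b : ℕ} {p : ℕ → ℕ} (p' : ℕ → ℕ)
    (h : IsNCMatching (a + 2 * n + b) p) :
    glue a n (juxtapose (a + 2 * n + b) p p') = juxtapose (a + b) (glue a n p) p' ∧
      glueLoops a n (juxtapose (a + 2 * n + b) p p') = glueLoops a n p := by
  induction n generalizing p with
  | zero => simp [glue, glueLoops]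
  | succ n ih =>
    have e : a + 2 * (n + 1) + b = a + 2 * n + b + 2 := by ring
    rw [e] at h ⊢
    simp only [glue_succ, glueLoops_succ, contract_juxtapose_left p' h (show a + n ≤ a + 2 * n + b by omega)]
    obtain ⟨h1, h2⟩ := ih (h.contract (i := a + n) (by omega))
    refine ⟨h1, ?_⟩
    rw [h2, loopAt_congr]
    rw [juxtapose_of_lt _ _ (by omega)]

theorem glue_juxtapose_right (n : ℕ) {N a b : ℕ} {p p' : ℕ → ℕ}
    (hp : ∀ x, x < N → p x < N) (h : IsNCMatching (a + 2 * n + b) p') :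
    glue (N + a) n (juxtapose N p p') = juxtapose N p (glue a n p') ∧
      glueLoops (N + a) n (juxtapose N p p') = glueLoops a n p' := by
  induction n generalizing p' with
  | zero => simp [glue, glueLoops]
  | succ n ih =>
    have h' : IsNCMatching (a + 2 * n + b + 2) p' := by convert h using 1; ring
    have hc := contract_juxtapose_right hp h' (show a + n ≤ a + 2 * n + b by omega)
    simp only [glue_succ, glueLoops_succ, show N + a + n = N + (a + n) by ring, hc]
    obtain ⟨h1, h2⟩ := ih (h'.contract (i := a + n) (by omega))
    refine ⟨h1, ?_⟩
    rw [h2, loopAt_congr]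
    rw [juxtapose_add]
    omega

/-- Both sides glue the juxtaposition of all three diagrams along the same two blocks of positions,
in opposite orders. -/
theorem SimpleDiagram.comp_assoc {m n k l : ℕ} (h : SimpleDiagram k l) (g : SimpleDiagram n k)
    (f : SimpleDiagram m n) : (h.comp g).comp f = h.comp (g.comp f) := by
  have lf : ∀ x, x < m + n → f.partner x < m + n := fun _ => f.isNCMatching.lt
  have nfg : IsNCMatching (m + 2 * n + k) (juxtapose (m + n) f.partner g.partner) := by
    convert f.isNCMatching.juxtapose g.isNCMatching using 1; ring
  have nall : IsNCMatching (m + 2 * n + 2 * k + l)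
      (juxtapose (m + 2 * n + k) (juxtapose (m + n) f.partner g.partner) h.partner) := by
    convert nfg.juxtapose h.isNCMatching using 1; ring
  have ja : juxtapose (m + 2 * n + k) (juxtapose (m + n) f.partner g.partner) h.partner =
      juxtapose (m + n) f.partner (juxtapose (n + k) g.partner h.partner) := by
    rw [← juxtapose_assoc]; congr 1; ring
  have a := glue_juxtapose_left n h.partner nfg
  have ngh : IsNCMatching (n + 2 * k + l) (juxtapose (n + k) g.partner h.partner) := by
    convert g.isNCMatching.juxtapose h.isNCMatching using 1; ring
  have b := glue_juxtapose_right k lf ngh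
  rw [show m + n + n = m + 2 * n by ring] at b
  have c := glue_glue n k (c := 0) nall
  have d := glue_glue_loops n k (c := 0) nall
  rw [add_zero, add_zero] at c d
  rw [a.1, a.2] at d
  rw [a.1] at c
  rw [ja, b.1] at c
  rw [ja, b.1, b.2] at d
  ext x
  · exact congrFun c x
  · simp only [comp]
    omega

/-! ### Contractions of insertions -/

/-- Relabelling of the positions after `N` positions have been inserted before `a`. -/
def shiftFrom (a N y : ℕ) : ℕ := if y < a then y else y + N

theorem insertAt_inside {a N x : ℕ} (p p' : ℕ → ℕ) (h : x < N) :
    insertAt a N p p' (a + x) = a + p x := by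
  rw [insertAt, if_pos (by omega), Nat.add_sub_cancel_left, add_comm]

theorem insertAt_shiftFrom (a N : ℕ) (p p' : ℕ → ℕ) (y : ℕ) :
    insertAt a N p p' (shiftFrom a N y) = shiftFrom a N (p' y) := by
  simp only [shiftFrom, insertAt]
  grind

theorem inside_or_shiftFrom (a N x : ℕ) : (∃ y, y < N ∧ x = a + y) ∨ ∃ y, x = shiftFrom a N y := by
  by_cases h : a ≤ x ∧ x < a + N
  · exact Or.inl ⟨x - a, by omega, by omega⟩
  · exact Or.inr ⟨if x < a then x else x - N, by simp only [shiftFrom]; grind⟩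

/-- The inserted positions and the shifted old ones exhaust `ℕ`, so an insertion can be recognised
separately on the two kinds. -/
theorem eq_insertAt {a N : ℕ} {p p' r : ℕ → ℕ} (h : ∀ x, x < N → r (a + x) = a + p x)
    (h' : ∀ y, r (shiftFrom a N y) = shiftFrom a N (p' y)) : r = insertAt a N p p' := by
  funext x
  obtain ⟨y, hy, rfl⟩ | ⟨y, rfl⟩ := inside_or_shiftFrom a N x
  · rw [h y hy, insertAt_inside _ _ hy]
  · rw [h', insertAt_shiftFrom]

/-- The partners in the diagram `id_n`. -/
abbrev nested (n : ℕ) : ℕ → ℕ := (SimpleDiagram.id n).partner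

theorem nested_isNCMatching (n : ℕ) : IsNCMatching (2 * n) (nested n) := by
  convert (SimpleDiagram.id n).isNCMatching using 1; ring

theorem nested_of_lt {n x : ℕ} (h : x < 2 * n) : nested n x = 2 * n - 1 - x := if_pos h

/-- Joining `b` to the first end of the outermost inserted arc only lengthens the strand at `b`. Its
end moves to the far end of that arc, behind the `t` remaining arcs. Repeating this straightens all
strands, whence the unit law. -/
theorem contract_insertAt_nested {M b t : ℕ} {f : ℕ → ℕ} (hf : IsNCMatching M f) (hb : b < M) :
    contract b (insertAt (b + 1) (2 * (t + 1)) (nested (t + 1)) f) =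
      insertAt b (2 * t) (nested t) f := by
  have in1 : ∀ z, z < 2 * t + 2 → insertAt (b + 1) (2 * (t + 1)) (nested (t + 1)) f (b + 1 + z) =
      b + 1 + (2 * t + 1 - z) := fun z hz => by
    rw [insertAt_inside _ _ (by omega), nested_of_lt (by omega)]; omega
  have out1 := insertAt_shiftFrom (b + 1) (2 * (t + 1)) (nested (t + 1)) f
  have fb := hf.ne_self b hb
  apply eq_insertAt
  · intro z hz
    rw [nested_of_lt hz, contract, skip_eq_add_two (by omega),
      show b + z + 2 = b + 1 + (z + 1) by omega, in1 _ (by omega), if_neg (by omega),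
      if_neg (by omega), unskip, if_neg (by omega)]
    omega
  · intro y
    have fy := hf.invol y
    have o0 := out1 b
    have o1 := out1 y
    have i0 := in1 0 (by omega)
    have i1 := in1 (2 * t + 1) (by omega)
    simp only [contract, skip, unskip, shiftFrom] at *
    clear in1 out1 hf
    grind

theorem loopAt_insertAt_nested (b t : ℕ) (f : ℕ → ℕ) :
    loopAt b (insertAt (b + 1) (2 * (t + 1)) (nested (t + 1)) f) = 0 := by
  have o := insertAt_shiftFrom (b + 1) (2 * (t + 1)) (nested (t + 1)) f b
  simp only [loopAt, shiftFrom] at *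
  grind

theorem insertAt_nested_zero (a : ℕ) (f : ℕ → ℕ) : insertAt a 0 (nested 0) f = f := by
  funext x
  simp only [insertAt]
  grind

theorem glue_insertAt_nested {M a t : ℕ} {f : ℕ → ℕ} (hf : IsNCMatching M f) (h : a + t ≤ M) :
    glue a t (insertAt (a + t) (2 * t) (nested t) f) = f ∧
      glueLoops a t (insertAt (a + t) (2 * t) (nested t) f) = 0 := by
  induction t with
  | zero => exact ⟨insertAt_nested_zero _ _, rfl⟩
  | succ t ih =>
    rw [glue_succ, glueLoops_succ, ← add_assoc, contract_insertAt_nested hf (by omega),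
      loopAt_insertAt_nested, zero_add]
    exact ih (by omega)

theorem juxtapose_eq_insertAt {N M : ℕ} {p p' : ℕ → ℕ} (hp : IsNCMatching N p)
    (hp' : IsNCMatching M p') : juxtapose N p p' = insertAt N M p' p := by
  apply eq_insertAt
  · intro x hx
    rw [juxtapose_add]
  · intro y
    have := hp.lt (x := y)
    have := hp.outside y
    have := hp'.outside (y + M - N)
    have := hp'.outside (y - N)
    simp only [shiftFrom, juxtapose]
    grind

theorem SimpleDiagram.id_comp {m n : ℕ} (f : SimpleDiagram m n) : (id n).comp f = f := by
  have := glue_insertAt_nested f.isNCMatching (a := m) (t := n) le_rfl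
  rw [← juxtapose_eq_insertAt f.isNCMatching (nested_isNCMatching n)] at this
  ext x
  · exact congrFun this.1 x
  · simp only [comp]
    rw [this.2]
    rfl

/-- Inserting `nested 1` adds one arc between neighbours, the combinatorial form of a cup. It does
not interact with a contraction to its left, which only shifts it by two. -/
theorem contract_insertAt_arc {M i j : ℕ} {p : ℕ → ℕ} (h : IsNCMatching (M + 2) p) (hij : i ≤ j)
    (hj : j ≤ M) :
    contract i (insertAt (j + 2) 2 (nested 1) p) = insertAt j 2 (nested 1) (contract i p) := by
  have hc := skip_contract h.invol (h.ne_self i (by omega)) (h.ne_self (i + 1) (by omega))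
  have o := insertAt_shiftFrom (j + 2) 2 (nested 1) p
  have e : ∀ x, skip i (shiftFrom j 2 x) = shiftFrom (j + 2) 2 (skip i x) := fun x => by
    simp only [skip, shiftFrom]; grind
  have u : ∀ x, unskip i (shiftFrom (j + 2) 2 (skip i x)) = shiftFrom j 2 x := fun x => by
    simp only [skip, unskip, shiftFrom]; grind
  have ei : shiftFrom (j + 2) 2 i = i := if_pos (by omega)
  have ei' : shiftFrom (j + 2) 2 (i + 1) = i + 1 := if_pos (by omega)
  apply eq_insertAt
  · intro x hx
    rw [contract, skip_eq_add_two (by omega), show j + x + 2 = j + 2 + x by ring,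
      insertAt_inside _ _ hx, if_neg (by omega), if_neg (by omega), unskip, if_neg (by omega)]
    omega
  · intro y
    have oi := o i
    have oi' := o (i + 1)
    rw [ei] at oi
    rw [ei'] at oi'
    have iff1 : ∀ z, shiftFrom (j + 2) 2 z = i ↔ z = i := fun z => by
      simp only [shiftFrom]; grind
    have iff2 : ∀ z, shiftFrom (j + 2) 2 z = i + 1 ↔ z = i + 1 := fun z => by
      simp only [shiftFrom]; grind
    rw [← u (contract i p y), hc, contract, e, o, oi, oi']
    simp only [iff1, iff2, apply_ite (shiftFrom (j + 2) 2)]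

theorem loopAt_insertAt_arc {i j : ℕ} (p : ℕ → ℕ) (hij : i ≤ j) :
    loopAt i (insertAt (j + 2) 2 (nested 1) p) = loopAt i p := by
  have o := insertAt_shiftFrom (j + 2) 2 (nested 1) p i
  apply loopAt_congr
  simp only [shiftFrom] at o
  grind

theorem juxtapose_insertAt {N a M : ℕ} {p : ℕ → ℕ} (p' p'' : ℕ → ℕ)
    (hp : ∀ x, x < N → p x < N) :
    juxtapose N p (insertAt a M p' p'') = insertAt (N + a) M p' (juxtapose N p p'') := by
  apply eq_insertAt
  · intro x hx
    rw [add_assoc, juxtapose_add, insertAt_inside _ _ hx, add_assoc]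
  · intro y
    by_cases hy : y < N
    · have := hp y hy
      simp only [juxtapose, shiftFrom]
      grind
    · obtain ⟨z, rfl⟩ := Nat.exists_eq_add_of_le (Nat.not_lt.1 hy)
      have s : ∀ z, shiftFrom (N + a) M (N + z) = N + shiftFrom a M z := fun z => by
        simp only [shiftFrom]; grind
      rw [s, juxtapose_add, juxtapose_add, s, insertAt_shiftFrom]

theorem nested_one_zero : nested 1 0 = 1 := rfl

theorem nested_one_one : nested 1 1 = 0 := rfl

theorem insertAt_arc_fst (a : ℕ) (p : ℕ → ℕ) : insertAt a 2 (nested 1) p a = a + 1 :=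
  insertAt_inside _ _ (x := 0) (by omega)

theorem insertAt_arc_snd (a : ℕ) (p : ℕ → ℕ) : insertAt a 2 (nested 1) p (a + 1) = a :=
  insertAt_inside _ _ (x := 1) (by omega)

theorem contract_insertAt_self (a : ℕ) (p : ℕ → ℕ) :
    contract a (insertAt a 2 (nested 1) p) = p := by
  funext x
  have o := insertAt_shiftFrom a 2 (nested 1) p x
  have e : skip a x = shiftFrom a 2 x := rfl
  rw [contract, e, o, if_neg, if_neg]
  all_goals simp only [shiftFrom, unskip]; grind

theorem contract_insertAt_succ {M a : ℕ} {p : ℕ → ℕ} (h : IsNCMatching M p) (ha : a < M) :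
    contract a (insertAt (a + 1) 2 (nested 1) p) = p := by
  simpa [insertAt_nested_zero] using contract_insertAt_nested (t := 0) h ha

/-- Contracting an arc between neighbours merely erases it, so inserting it again restores the
matching. This is how a cup is split off a diagram. -/
theorem insertAt_contract_self {M a : ℕ} {p : ℕ → ℕ} (h : IsNCMatching (M + 2) p)
    (hp : p a = a + 1) (ha : a ≤ M) : insertAt a 2 (nested 1) (contract a p) = p := by
  have hc := skip_contract h.invol (h.ne_self a (by omega)) (h.ne_self (a + 1) (by omega))
  have e : ∀ x, shiftFrom a 2 x = skip a x := fun x => rfl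
  have hp' : p (a + 1) = a := by rw [← hp, h.invol]
  symm
  apply eq_insertAt
  · intro x hx
    interval_cases x
    · exact hp
    · exact hp'
  · intro y
    have := h.invol (skip a y)
    have := skip_ne a y
    rw [e, e, hc]
    grind

/-! ### Adding a through-string on the right -/

/-- Surround a matching of `0, …, N - 1` by an arc. -/
abbrev wrap (N : ℕ) (p : ℕ → ℕ) : ℕ → ℕ := insertAt 1 N p (nested 1)

theorem wrap_zero (N : ℕ) (p : ℕ → ℕ) : wrap N p 0 = N + 1 := by
  have := insertAt_shiftFrom 1 N p (nested 1) 0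
  simpa [shiftFrom, nested_one_zero, add_comm] using this

theorem wrap_last (N : ℕ) (p : ℕ → ℕ) : wrap N p (N + 1) = 0 := by
  have := insertAt_shiftFrom 1 N p (nested 1) 1
  simpa [shiftFrom, nested_one_one, add_comm] using this

theorem wrap_succ {N x : ℕ} (p : ℕ → ℕ) (h : x < N) : wrap N p (x + 1) = p x + 1 := by
  rw [add_comm x, add_comm (p x)]
  exact insertAt_inside _ _ h

theorem eq_wrap {N : ℕ} {p r : ℕ → ℕ} (h : ∀ x, x < N → r (x + 1) = p x + 1)
    (h0 : r 0 = N + 1) (h1 : r (N + 1) = 0) (h2 : ∀ x, N + 2 ≤ x → r x = x) : r = wrap N p := by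
  apply eq_insertAt
  · intro x hx
    rw [add_comm 1, h x hx, add_comm]
  · intro y
    obtain _ | _ | y := y
    · simpa [shiftFrom, nested_one_zero, add_comm] using h0
    · simpa [shiftFrom, nested_one_one, add_comm] using h1
    · have e := (nested_isNCMatching 1).outside (y + 2) (by omega)
      rw [e]
      exact h2 (y + 2 + N) (by omega)

theorem wrap_isNCMatching {N : ℕ} {p : ℕ → ℕ} (h : IsNCMatching N p) :
    IsNCMatching (N + 2) (wrap N p) :=
  h.insertAt (nested_isNCMatching 1) (by omega)

theorem contract_wrap {N i : ℕ} {p : ℕ → ℕ} (h : IsNCMatching (N + 2) p) (hi : i ≤ N) :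
    contract (i + 1) (wrap (N + 2) p) = wrap N (contract i p) := by
  have hc := skip_contract h.invol (h.ne_self i (by omega)) (h.ne_self (i + 1) (by omega))
  have w := fun x hx => wrap_succ (N := N + 2) (x := x) p hx
  have w0 := wrap_zero (N + 2) p
  have w1 := wrap_last (N + 2) p
  apply eq_wrap
  · intro x hx
    have e : skip (i + 1) (x + 1) = skip i x + 1 := by simp only [skip]; grind
    have hs : skip i x < N + 2 := by simp only [skip]; grind
    have u : ∀ x, unskip (i + 1) (skip i x + 1) = x + 1 := fun x => by
      simp only [skip, unskip]; grind
    rw [← u (contract i p x), hc, contract, e, w _ hs, w _ (by omega), w _ (by omega)]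
    simp only [add_left_inj, apply_ite (· + 1)]
  · simp only [contract, skip, unskip]; grind
  · simp only [contract, skip, unskip]; grind
  · intro x hx
    have := (wrap_isNCMatching h).outside (x + 2) (by omega)
    simp only [contract, skip, unskip]; grind

theorem loopAt_wrap {N i : ℕ} {p : ℕ → ℕ} (hi : i < N) :
    loopAt (i + 1) (wrap N p) = loopAt i p := by
  apply loopAt_congr
  rw [wrap_succ _ hi]
  omega

theorem glue_wrap (n : ℕ) {a b : ℕ} {p : ℕ → ℕ} (h : IsNCMatching (a + 2 * n + b) p) :
    glue (a + 1) n (wrap (a + 2 * n + b) p) = wrap (a + b) (glue a n p) ∧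
      glueLoops (a + 1) n (wrap (a + 2 * n + b) p) = glueLoops a n p := by
  induction n generalizing p with
  | zero => exact ⟨rfl, rfl⟩
  | succ n ih =>
    have e : a + 2 * (n + 1) + b = a + 2 * n + b + 2 := by ring
    rw [e] at h ⊢
    obtain ⟨h1, h2⟩ := ih (h.contract (i := a + n) (by omega))
    rw [glue_succ, glueLoops_succ, glueLoops_succ, show a + 1 + n = a + n + 1 by ring,
      contract_wrap h (by omega), loopAt_wrap (by omega), h1, h2]
    exact ⟨rfl, rfl⟩

/-- The two extra through-strings face each other at `N + 1` and `N + 2`, and joining them fuses the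
two outer arcs into one. This is the first of the `n + 1` contractions in a composite of diagrams `-
⊗ id_1`; `glue_wrap` handles the others. -/
theorem contract_juxtapose_wrap {N N' : ℕ} {p p' : ℕ → ℕ} (h : IsNCMatching N p)
    (h' : IsNCMatching N' p') :
    contract (N + 1) (juxtapose (N + 2) (wrap N p) (wrap N' p')) =
      wrap (N + N') (juxtapose N p p') := by
  have a0 := juxtapose_of_lt (wrap N p) (wrap N' p') (show 0 < N + 2 by omega)
  have a1 := juxtapose_of_lt (wrap N p) (wrap N' p') (show N + 1 < N + 2 by omega)
  have b0 := juxtapose_add (N + 2) (wrap N p) (wrap N' p') 0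
  have b1 := juxtapose_add (N + 2) (wrap N p) (wrap N' p') (N' + 1)
  rw [wrap_zero] at a0 b0
  rw [wrap_last] at a1 b1
  apply eq_wrap
  · intro x hx
    by_cases hxN : x < N
    · have := h.lt hxN
      have c := juxtapose_of_lt (wrap N p) (wrap N' p') (show x + 1 < N + 2 by omega)
      rw [wrap_succ _ hxN] at c
      rw [juxtapose_of_lt _ _ hxN, contract, skip_eq_self (by omega), c, if_neg (by omega),
        if_neg (by omega), unskip, if_pos (by omega)]
    · obtain ⟨y, rfl⟩ := Nat.exists_eq_add_of_le (Nat.not_lt.1 hxN)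
      have c := juxtapose_add (N + 2) (wrap N p) (wrap N' p') (y + 1)
      rw [wrap_succ _ (by omega)] at c
      rw [juxtapose_add, contract, skip_eq_add_two (by omega),
        show N + y + 1 + 2 = N + 2 + (y + 1) by ring, c, if_neg (by omega),
        if_neg (by omega), unskip, if_neg (by omega)]
      omega
  · simp only [contract, skip, unskip]; grind
  · simp only [contract, skip, unskip]; grind
  · intro x hx
    have := ((wrap_isNCMatching h).juxtapose (wrap_isNCMatching h')).outside (x + 2) (by omega)
    simp only [contract, skip, unskip]; grind

/-- The top ends of the two extra through-strings sit at `M + 2` and `M + 3`, their bottom ends at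
`1` and `0`. Capping the former leaves an arc between the latter. -/
theorem contract_wrap_wrap {M : ℕ} {p : ℕ → ℕ} (h : IsNCMatching M p) :
    contract (M + 2) (wrap (M + 2) (wrap M p)) = insertAt 0 2 (nested 1) p := by
  have a0 := wrap_zero (M + 2) (wrap M p)
  have a1 := wrap_last (M + 2) (wrap M p)
  have b0 := wrap_succ (N := M + 2) (x := 0) (wrap M p) (by omega)
  have b1 := wrap_succ (N := M + 2) (x := M + 1) (wrap M p) (by omega)
  rw [wrap_zero] at b0
  rw [wrap_last] at b1
  apply eq_insertAt
  · intro x hx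
    interval_cases x
    · rw [nested_one_zero]; simp only [contract, skip, unskip]; grind
    · rw [nested_one_one]; simp only [contract, skip, unskip]; grind
  · intro y
    have e : ∀ y, shiftFrom 0 2 y = y + 2 := fun y => rfl
    rw [e, e]
    by_cases hy : y < M
    · have := h.lt hy
      have c := wrap_succ (N := M + 2) (x := y + 1) (wrap M p) (by omega)
      rw [wrap_succ p hy] at c
      simp only [contract, skip, unskip]; grind
    · have := h.outside y (by omega)
      have := (wrap_isNCMatching (wrap_isNCMatching h)).outside (y + 4) (by omega)
      simp only [contract, skip, unskip]; grind

theorem SimpleDiagram.tensor_comp_tensor {m n k : ℕ} (g : SimpleDiagram n k)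
    (f : SimpleDiagram m n) :
    (g.tensor (id 1)).comp (f.tensor (id 1)) = (g.comp f).tensor (id 1) := by
  have hj : IsNCMatching (m + 2 * n + k) (juxtapose (m + n) f.partner g.partner) := by
    convert f.isNCMatching.juxtapose g.isNCMatching using 1; ring
  have hc := contract_juxtapose_wrap f.isNCMatching g.isNCMatching
  rw [show m + n + (n + k) = m + 2 * n + k by ring] at hc
  obtain ⟨h1, h2⟩ := glue_wrap n hj
  have e : m + 1 + n = m + n + 1 := by ring
  have e' : m + 1 + (n + 1) = m + n + 2 := by ring
  have l : loopAt (m + n + 1)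
      (juxtapose (m + n + 2) (wrap (m + n) f.partner) (wrap (n + k) g.partner)) = 0 := by
    rw [loopAt, juxtapose_of_lt _ _ (by omega), wrap_last, if_neg (by omega)]
  ext x
  · change glue (m + 1) (n + 1) (juxtapose (m + 1 + (n + 1)) (wrap (m + n) f.partner)
      (wrap (n + k) g.partner)) x = wrap (m + k) (glue m n _) x
    rw [glue_succ, e, e', hc, h1]
  · change f.loops + 0 + (g.loops + 0) + glueLoops (m + 1) (n + 1) (juxtapose (m + 1 + (n + 1))
      (wrap (m + n) f.partner) (wrap (n + k) g.partner)) = f.loops + g.loops + glueLoops m n _ + 0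
    rw [glueLoops_succ, e, e', hc, h2, l]
    omega

theorem SimpleDiagram.id_tensor_id (n : ℕ) : (id n).tensor (id 1) = id (n + 1) := by
  ext x
  · refine congrFun (Eq.symm (eq_wrap ?_ ?_ ?_ ?_)) x <;> simp only [id] <;> grind
  · rfl

/-! ### Reflection -/

/-- Reverse the order of the positions `0, …, N - 1`. -/
def reverse (N : ℕ) (p : ℕ → ℕ) (x : ℕ) : ℕ := if x < N then N - 1 - p (N - 1 - x) else x

theorem reverse_isNCMatching {N : ℕ} {p : ℕ → ℕ} (h : IsNCMatching N p) :
    IsNCMatching N (reverse N p) := by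
  -- A matching of `N` positions is a loop-free diagram `0 → N`, and its reflection reverses the
  -- positions.
  have := (SimpleDiagram.reflect (m := 0) ⟨p, by rwa [zero_add], 0⟩).isNCMatching
  simp only [SimpleDiagram.reflect, zero_add, add_zero] at this
  exact this

theorem reverse_apply {N x y : ℕ} (p : ℕ → ℕ) (h : x + y + 1 = N) :
    reverse N p x = N - 1 - p y := by
  rw [reverse, if_pos (by omega), show N - 1 - x = y by omega]

theorem reverse_reverse {N : ℕ} {p : ℕ → ℕ} (h : IsNCMatching N p) :
    reverse N (reverse N p) = p := by
  funext x
  have := h.lt (x := x)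
  have := h.outside x
  simp only [reverse]
  grind

theorem reverse_contract {N i j : ℕ} {p : ℕ → ℕ} (h : IsNCMatching (N + 2) p) (hij : i + j = N) :
    reverse N (contract i p) = contract j (reverse (N + 2) p) := by
  have h' := reverse_isNCMatching h
  have hc := skip_contract h.invol (h.ne_self i (by omega)) (h.ne_self (i + 1) (by omega))
  have hc' := skip_contract h'.invol (h'.ne_self j (by omega)) (h'.ne_self (j + 1) (by omega))
  funext x
  by_cases hx : x < N
  · apply skip_injective j
    rw [hc']
    have l := (h.contract (i := i) (by omega)).lt (x := N - 1 - x) (by omega)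
    have e : ∀ y, y < N → skip j (N - 1 - y) = N + 1 - skip i y := fun y hy => by
      simp only [skip]; grind
    have e' : skip j x = N + 1 - skip i (N - 1 - x) := by
      rw [← e _ (by omega)]; congr 1; omega
    have hs : skip i (N - 1 - x) < N + 2 := by simp only [skip]; grind
    have := h.lt hs
    have := h.lt (x := i) (by omega)
    have := h.lt (x := i + 1) (by omega)
    rw [reverse_apply _ (show x + (N - 1 - x) + 1 = N by omega), e _ l, hc, e',
      reverse_apply p (y := skip i (N - 1 - x)) (by omega), reverse_apply p (y := i) (by omega),
      reverse_apply p (y := i + 1) (by omega)]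
    grind
  · have e : reverse (N + 2) p (x + 2) = x + 2 := if_neg (by omega)
    rw [reverse, if_neg hx, contract, skip_eq_add_two (by omega), e,
      if_neg (by omega), if_neg (by omega), unskip, if_neg (by omega)]
    omega

theorem loopAt_reverse {N i j : ℕ} {p : ℕ → ℕ} (h : IsNCMatching (N + 2) p) (hij : i + j = N) :
    loopAt j (reverse (N + 2) p) = loopAt i p := by
  apply loopAt_congr
  rw [reverse_apply p (y := i + 1) (by omega)]
  have := h.lt (x := i + 1) (by omega)
  have := h.invol i
  have := h.invol (i + 1)
  grind

/-- Each stage of the gluing joins the central pair of the remaining block. Reversal sends central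
pairs to central pairs, so the stages correspond one by one and need not be reordered. -/
theorem reverse_glue (n : ℕ) {a b : ℕ} {p : ℕ → ℕ} (h : IsNCMatching (a + 2 * n + b) p) :
    reverse (a + b) (glue a n p) = glue b n (reverse (a + 2 * n + b) p) ∧
      glueLoops b n (reverse (a + 2 * n + b) p) = glueLoops a n p := by
  induction n generalizing p with
  | zero => exact ⟨rfl, rfl⟩
  | succ n ih =>
    have e : a + 2 * (n + 1) + b = a + 2 * n + b + 2 := by ring
    rw [e] at h ⊢
    obtain ⟨h1, h2⟩ := ih (h.contract (i := a + n) (by omega))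
    have e' : a + n + (b + n) = a + 2 * n + b := by ring
    rw [glue_succ, glue_succ, glueLoops_succ, glueLoops_succ, ← reverse_contract h e', h1, h2,
      loopAt_reverse h e']
    exact ⟨rfl, rfl⟩

theorem reverse_juxtapose {N N' : ℕ} {p : ℕ → ℕ} (h : IsNCMatching N p)
    (p' : ℕ → ℕ) :
    reverse (N + N') (juxtapose N p p') = juxtapose N' (reverse N' p') (reverse N p) := by
  funext x
  by_cases hx : x < N'
  · rw [juxtapose_of_lt _ _ hx, reverse_apply (y := N + (N' - 1 - x)) _ (by omega), juxtapose_add,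
      reverse_apply (y := N' - 1 - x) _ (by omega)]
    omega
  · obtain ⟨y, rfl⟩ := Nat.exists_eq_add_of_le (Nat.not_lt.1 hx)
    rw [juxtapose_add]
    by_cases hy : y < N
    · have := h.lt (x := N - 1 - y) (by omega)
      rw [reverse_apply (y := N - 1 - y) _ (by omega), juxtapose_of_lt _ _ (by omega),
        reverse_apply (y := N - 1 - y) _ (by omega)]
      omega
    · rw [reverse, if_neg (by omega), reverse, if_neg (by omega)]

theorem reverse_wrap {N : ℕ} {p : ℕ → ℕ} (h : IsNCMatching N p) :
    reverse (N + 2) (wrap N p) = wrap N (reverse N p) := by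
  apply eq_wrap
  · intro x hx
    have := h.lt (x := N - 1 - x) (by omega)
    rw [reverse_apply (y := N - 1 - x + 1) _ (by omega), wrap_succ _ (by omega),
      reverse_apply (y := N - 1 - x) _ (by omega)]
    omega
  · rw [reverse_apply (y := N + 1) _ (by omega), wrap_last]
    omega
  · rw [reverse_apply (y := 0) _ (by omega), wrap_zero]
    omega
  · intro x hx
    rw [reverse, if_neg (by omega)]

theorem reverse_insertAt_arc {M a b : ℕ} {p : ℕ → ℕ} (h : IsNCMatching M p) (hab : a + b = M) :
    reverse (M + 2) (insertAt a 2 (nested 1) p) = insertAt b 2 (nested 1) (reverse M p) := by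
  have i0 := insertAt_arc_fst a p
  have i1 := insertAt_arc_snd a p
  apply eq_insertAt
  · intro x hx
    interval_cases x
    · rw [reverse_apply (y := a + 1) _ (by omega), i1, nested_one_zero]; omega
    · rw [reverse_apply (y := a) _ (by omega), i0, nested_one_one]; omega
  · intro y
    by_cases hy : y < M
    · have e : ∀ y, y < M → shiftFrom b 2 (M - 1 - y) = M + 1 - shiftFrom a 2 y := fun y hy => by
        simp only [shiftFrom]; grind
      have l := h.lt (x := M - 1 - y) (by omega)
      have e' : shiftFrom a 2 (M - 1 - y) = M + 1 - shiftFrom b 2 y := by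
        simp only [shiftFrom]; grind
      have l' : shiftFrom b 2 y < M + 2 := by simp only [shiftFrom]; grind
      have e2 := reverse_apply (N := M) (x := y) (y := M - 1 - y) p (by omega)
      rw [e2, e _ l, reverse_apply (y := shiftFrom a 2 (M - 1 - y)) _ (by omega),
        insertAt_shiftFrom]
      rfl
    · have e : shiftFrom b 2 y = y + 2 := if_neg (by omega)
      rw [e, reverse, if_neg (by omega), reverse, if_neg hy, e]

namespace SimpleDiagram

theorem reflect_partner {m n : ℕ} (f : SimpleDiagram m n) :
    f.reflect.partner = reverse (m + n) f.partner := rfl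

theorem reflect_reflect {m n : ℕ} (f : SimpleDiagram m n) : f.reflect.reflect = f := by
  ext x
  · rw [reflect_partner, reflect_partner, add_comm n m, reverse_reverse f.isNCMatching]
  · rfl

theorem reflect_comp {m n k : ℕ} (g : SimpleDiagram n k) (f : SimpleDiagram m n) :
    (g.comp f).reflect = f.reflect.comp g.reflect := by
  have hj : IsNCMatching (m + 2 * n + k) (juxtapose (m + n) f.partner g.partner) := by
    convert f.isNCMatching.juxtapose g.isNCMatching using 1; ring
  obtain ⟨h1, h2⟩ := reverse_glue n hj
  have e := reverse_juxtapose (N' := n + k) f.isNCMatching g.partner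
  rw [show m + n + (n + k) = m + 2 * n + k by ring] at e
  rw [e] at h1 h2
  ext x
  · rw [reflect_partner]
    change reverse (m + k) (glue m n _) x = glue k n (juxtapose (k + n) (reverse _ _) (reverse _ _)) x
    rw [h1, add_comm k n]
  · change f.loops + g.loops + glueLoops m n _ =
      g.loops + f.loops + glueLoops k n (juxtapose (k + n) (reverse _ _) (reverse _ _))
    rw [← h2, add_comm k n, add_comm f.loops]

theorem reflect_id (n : ℕ) : (id n).reflect = id n := by
  ext x
  · simp only [reflect, id]
    grind
  · rfl

theorem comp_id {m n : ℕ} (f : SimpleDiagram m n) : f.comp (id m) = f := by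
  rw [← reflect_reflect (f.comp (id m)), reflect_comp, reflect_id, id_comp, reflect_reflect]

theorem reflect_tensor_id {m n : ℕ} (f : SimpleDiagram m n) :
    (f.tensor (id 1)).reflect = f.reflect.tensor (id 1) := by
  ext x
  · change reverse (m + 1 + (n + 1)) (wrap (m + n) f.partner) x =
      wrap (n + m) (reverse (m + n) f.partner) x
    rw [← add_comm m n, ← reverse_wrap f.isNCMatching,
      show m + 1 + (n + 1) = m + n + 2 by ring]
  · rfl

end SimpleDiagram

/-! ### Cups and caps -/

theorem glue_insertAt_arc (n : ℕ) {a b c : ℕ} {p : ℕ → ℕ} (h : IsNCMatching (a + 2 * n + b) p)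
    (hc : c ≤ b) :
    glue a n (insertAt (a + 2 * n + c) 2 (nested 1) p) =
        insertAt (a + c) 2 (nested 1) (glue a n p) ∧
      glueLoops a n (insertAt (a + 2 * n + c) 2 (nested 1) p) = glueLoops a n p := by
  induction n generalizing p with
  | zero => exact ⟨rfl, rfl⟩
  | succ n ih =>
    have h' : IsNCMatching (a + 2 * n + b + 2) p := by convert h using 1; ring
    obtain ⟨h1, h2⟩ := ih (h'.contract (i := a + n) (by omega))
    rw [glue_succ, glueLoops_succ, glueLoops_succ,
      show a + 2 * (n + 1) + c = a + 2 * n + c + 2 by ring,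
      contract_insertAt_arc h' (by omega) (by omega), loopAt_insertAt_arc _ (by omega), h1, h2]
    exact ⟨rfl, rfl⟩

theorem glue_one (a : ℕ) (p : ℕ → ℕ) : glue a 1 p = contract a p := rfl

theorem glueLoops_one (a : ℕ) (p : ℕ → ℕ) : glueLoops a 1 p = loopAt a p := rfl

namespace SimpleDiagram

/-- The cup joining the top points with the indices `i` and `i + 1`, counted from `0`. -/
def cupAt (n i : ℕ) (h : i ≤ n) : SimpleDiagram n (n + 2) :=
  cup (n + 2) (i + 1) (by omega) (by omega)

/-- The cap joining the bottom points with the indices `i` and `i + 1`, counted from `0`. -/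
def capAt (n i : ℕ) (h : i ≤ n) : SimpleDiagram (n + 2) n :=
  cap (n + 2) (i + 1) (by omega) (by omega)

theorem reflect_cupAt (n i : ℕ) (h : i ≤ n) : (cupAt n i h).reflect = capAt n i h := rfl

theorem reflect_capAt (n i : ℕ) (h : i ≤ n) : (capAt n i h).reflect = cupAt n i h :=
  reflect_reflect _

theorem cupAt_partner (n i : ℕ) (h : i ≤ n) :
    (cupAt n i h).partner = insertAt (n + i) 2 (nested 1) (nested n) := by
  apply eq_insertAt
  · intro x hx
    interval_cases x <;> simp only [cupAt, cup, nested, id] <;> grind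
  · intro y
    have e : nested n y = if y < 2 * n then 2 * n - 1 - y else y := rfl
    rw [e]
    simp only [cupAt, cup, shiftFrom]
    grind

/-- By `cupAt_partner` the cup is `id_n` with an arc inserted among its top points, to the right of
the glued block. The gluing leaves that arc alone and straightens `id_n`. -/
theorem cup_comp {m n i : ℕ} (h : i ≤ n) (g : SimpleDiagram m n) :
    ((cupAt n i h).comp g).partner = insertAt (m + i) 2 (nested 1) g.partner ∧
      ((cupAt n i h).comp g).loops = g.loops := by
  have hn : IsNCMatching (m + 2 * n + n) (juxtapose (m + n) g.partner (nested n)) := by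
    convert g.isNCMatching.juxtapose (nested_isNCMatching n) using 1; ring
  have hj := juxtapose_insertAt (N := m + n) (a := n + i) (M := 2) (nested 1) (nested n)
    (fun _ => g.isNCMatching.lt)
  obtain ⟨h1, h2⟩ := glue_insertAt_arc n hn h
  obtain ⟨h3, h4⟩ := glue_insertAt_nested g.isNCMatching (a := m) (t := n) le_rfl
  rw [← juxtapose_eq_insertAt g.isNCMatching (nested_isNCMatching n)] at h3 h4
  rw [show m + 2 * n + i = m + n + (n + i) by ring, ← hj, h3] at h1
  rw [show m + 2 * n + i = m + n + (n + i) by ring, ← hj, h4] at h2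
  constructor
  · change glue m n (juxtapose (m + n) g.partner (cupAt n i h).partner) = _
    rw [cupAt_partner, h1]
  · simp only [comp]
    rw [cupAt_partner, h2]
    rfl

/-- The cap is viewed as `id_{n+2}` with two neighbouring top ends joined. Composing with it then
means composing with an identity and contracting once more, and `glue_glue` lets the contraction
come last. -/
theorem capAt_partner (n i : ℕ) (h : i ≤ n) :
    (capAt n i h).partner = contract (n + 2 + i) (nested (n + 2)) := by
  have e := reverse_insertAt_arc (a := n + i) (b := n - i) (nested_isNCMatching n) (by omega)
  have e' : reverse (2 * n) (nested n) = nested n := by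
    rw [two_mul]
    exact congrArg partner (reflect_id n)
  rw [← reflect_cupAt, reflect_partner, cupAt_partner,
    show n + (n + 2) = 2 * n + 2 by ring, e, e']
  symm
  have g : ∀ m y, nested m y = if y < 2 * m then 2 * m - 1 - y else y := fun _ _ => rfl
  apply eq_insertAt
  · intro x hx
    interval_cases x <;> simp only [contract, g, skip, unskip] <;> grind
  · intro y
    rw [g n]
    simp only [contract, g, skip, unskip, shiftFrom]
    grind

theorem cap_comp {m n i : ℕ} (h : i ≤ n) (f : SimpleDiagram m (n + 2)) :
    ((capAt n i h).comp f).partner = contract (m + i) f.partner ∧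
      ((capAt n i h).comp f).loops = f.loops + loopAt (m + i) f.partner := by
  have lf : ∀ x, x < m + (n + 2) → f.partner x < m + (n + 2) := fun _ => f.isNCMatching.lt
  have hi : IsNCMatching (2 * n + 2 + 2) (nested (n + 2)) :=
    nested_isNCMatching (n + 2)
  have hn : IsNCMatching (m + 2 * (n + 2) + i + 2 * 1 + (n - i))
      (juxtapose (m + (n + 2)) f.partner (nested (n + 2))) := by
    convert f.isNCMatching.juxtapose hi using 1; omega
  have hj := contract_juxtapose_right lf hi (show n + 2 + i ≤ 2 * n + 2 by omega)
  obtain ⟨h3, h4⟩ := glue_insertAt_nested f.isNCMatching (a := m) (t := n + 2) le_rfl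
  rw [← juxtapose_eq_insertAt f.isNCMatching (nested_isNCMatching _)] at h3 h4
  have h1 := glue_glue (n + 2) 1 hn
  have h2 := glue_glue_loops (n + 2) 1 hn
  rw [glue_one, glue_one] at h1
  rw [glue_one, glueLoops_one, glueLoops_one] at h2
  have l : loopAt (m + (n + 2) + (n + 2 + i))
      (juxtapose (m + (n + 2)) f.partner (nested (n + 2))) = 0 := by
    rw [loopAt, juxtapose_add, nested_of_lt (by omega), if_neg (by omega)]
  have e : m + 2 * (n + 2) + i = m + (n + 2) + (n + 2 + i) := by ring
  rw [e, hj, h3] at h1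
  rw [e, hj, h3, h4, l, zero_add, zero_add] at h2
  constructor
  · change glue m (n + 2) (juxtapose (m + (n + 2)) f.partner (capAt n i h).partner) = _
    rw [capAt_partner, h1]
  · simp only [comp]
    rw [capAt_partner, h2]
    rfl

theorem cap_comp_cup (n i : ℕ) (h : i ≤ n) :
    (capAt n i h).comp (cupAt n i h) = (id n).addLoop := by
  obtain ⟨h1, h2⟩ := cap_comp h (cupAt n i h)
  ext x
  · rw [h1, cupAt_partner, contract_insertAt_self]
    rfl
  · rw [h2, cupAt_partner, loopAt, insertAt_arc_fst, if_pos rfl]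
    rfl

theorem cap_comp_cup_succ (n i : ℕ) (h : i + 1 ≤ n) :
    (capAt n i (by omega)).comp (cupAt n (i + 1) h) = id n := by
  obtain ⟨h1, h2⟩ := cap_comp (show i ≤ n by omega) (cupAt n (i + 1) h)
  -- The top point of index `i` of this cup lies on a through-string, so the cap closes no loop.
  have e := insertAt_shiftFrom (n + (i + 1)) 2 (nested 1) (nested n) (n + i)
  rw [shiftFrom, if_pos (by omega), nested_of_lt (by omega), shiftFrom, if_pos (by omega)] at e
  ext x
  · rw [h1, cupAt_partner, ← add_assoc,
      contract_insertAt_succ (nested_isNCMatching n) (by omega)]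
  · rw [h2, cupAt_partner, loopAt, e, if_neg (by omega)]
    rfl

theorem cap_succ_comp_cup (n i : ℕ) (h : i + 1 ≤ n) :
    (capAt n (i + 1) h).comp (cupAt n i (by omega)) = id n := by
  rw [← reflect_reflect ((capAt n (i + 1) h).comp (cupAt n i _)), reflect_comp, reflect_cupAt,
    reflect_capAt, cap_comp_cup_succ, reflect_id]

theorem cap_comp_tensor {m n i : ℕ} (h : i ≤ n) (f : SimpleDiagram m (n + 2)) :
    (capAt (n + 1) i (by omega)).comp (f.tensor (id 1)) =
      ((capAt n i h).comp f).tensor (id 1) := by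
  obtain ⟨h1, h2⟩ := cap_comp h f
  obtain ⟨h3, h4⟩ := cap_comp (m := m + 1) (n := n + 1) (i := i) (by omega) (f.tensor (id 1))
  have e : (f.tensor (id 1)).partner = wrap (m + n + 2) f.partner := rfl
  rw [e, show m + 1 + i = m + i + 1 by ring] at h3 h4
  rw [contract_wrap (N := m + n) f.isNCMatching (by omega)] at h3
  rw [loopAt_wrap (by omega)] at h4
  ext x
  · rw [h3, ← h1]
    rfl
  · rw [h4]
    change _ = ((capAt n i h).comp f).loops + 0
    rw [h2]
    rfl

theorem capAt_tensor {n i : ℕ} (h : i ≤ n) :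
    (capAt n i h).tensor (id 1) = capAt (n + 1) i (by omega) := by
  rw [← comp_id (capAt n i h), ← cap_comp_tensor h, id_tensor_id, comp_id]

theorem cupAt_tensor {n i : ℕ} (h : i ≤ n) :
    (cupAt n i h).tensor (id 1) = cupAt (n + 1) i (by omega) := by
  rw [← reflect_capAt, ← reflect_tensor_id, capAt_tensor, reflect_capAt]

/-- Reflection of `cup_comp`. The arc appears at `m - i` because bottom points are numbered from
right to left. -/
theorem comp_cap {m n i : ℕ} (h : i ≤ m) (f : SimpleDiagram m n) :
    (f.comp (capAt m i h)).partner = insertAt (m - i) 2 (nested 1) f.partner ∧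
      (f.comp (capAt m i h)).loops = f.loops := by
  have hc : f.comp (capAt m i h) = ((cupAt m i h).comp f.reflect).reflect := by
    rw [reflect_comp, reflect_reflect, reflect_cupAt]
  obtain ⟨h1, h2⟩ := cup_comp h f.reflect
  rw [hc]
  constructor
  · rw [reflect_partner, h1, ← add_assoc,
      reverse_insertAt_arc f.reflect.isNCMatching (b := m - i) (by omega), ← reflect_partner,
      reflect_reflect]
  · exact h2

theorem cap_comp_tensor_tensor {m n : ℕ} (f : SimpleDiagram m n) :
    (capAt n n le_rfl).comp ((f.tensor (id 1)).tensor (id 1)) = f.comp (capAt m m le_rfl) := by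
  obtain ⟨h1, h2⟩ := comp_cap le_rfl f
  obtain ⟨h3, h4⟩ := cap_comp (n := n) (i := n) le_rfl ((f.tensor (id 1)).tensor (id 1))
  have e : ((f.tensor (id 1)).tensor (id 1)).partner =
      wrap (m + n + 2) (wrap (m + n) f.partner) := by
    rw [show m + n + 2 = m + 1 + (n + 1) by ring]
    rfl
  rw [e, show m + 1 + 1 + n = m + n + 2 by ring] at h3 h4
  ext x
  · rw [h3, h1, contract_wrap_wrap f.isNCMatching, Nat.sub_self]
  · rw [h4, h2, loopAt, wrap_succ (x := m + n + 1) _ (by omega), wrap_last, if_neg (by omega)]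
    rfl

/-! ### Cups and caps split off non-identity diagrams -/

theorem cup_comp_partner_ne_id {n i : ℕ} (h : i ≤ n) (f : SimpleDiagram (n + 2) n) :
    ((cupAt n i h).comp f).partner ≠ (id (n + 2)).partner := by
  intro hc
  have e := congrFun hc (n + 2 + i)
  rw [(cup_comp h f).1, insertAt_arc_fst] at e
  have := nested_of_lt (n := n + 2) (x := n + 2 + i) (by omega)
  rw [nested] at this
  omega

theorem comp_cap_partner_ne_id {n i : ℕ} (h : i ≤ n) (f : SimpleDiagram n (n + 2)) :
    (f.comp (capAt n i h)).partner ≠ (id (n + 2)).partner := by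
  intro hc
  have e := congrFun hc (n - i)
  rw [(comp_cap h f).1, insertAt_arc_fst] at e
  have := nested_of_lt (n := n + 2) (x := n - i) (by omega)
  rw [nested] at this
  omega

/-- The cap closes the arc at the top of `f` into a loop and the cup puts the arc back. -/
theorem cup_comp_cap_comp {m n i : ℕ} (h : i ≤ n) (f : SimpleDiagram m (n + 2))
    (hf : f.partner (m + i) = m + i + 1) :
    (cupAt n i h).comp ((capAt n i h).comp f) = f.addLoop := by
  obtain ⟨h1, h2⟩ := cup_comp h ((capAt n i h).comp f)
  obtain ⟨h3, h4⟩ := cap_comp h f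
  ext x
  · rw [h1, h3, insertAt_contract_self (M := m + n) f.isNCMatching hf (by omega)]
    rfl
  · rw [h2, h4, loopAt, if_pos hf]
    rfl

/-- Without an arc between neighbouring top points there is no arc between top points at all. Every
top point is then joined to a bottom point, and noncrossing forces the order of the through-strings.
-/
theorem exists_top_arc {n : ℕ} (f : SimpleDiagram n n) (hf : f.partner ≠ (id n).partner) :
    ∃ i, i + 2 ≤ n ∧ f.partner (n + i) = n + i + 1 := by
  obtain ⟨inv, ne, out, nc⟩ := f.isNCMatching
  have lt : ∀ x, x < n + n → f.partner x < n + n := fun _ => f.isNCMatching.lt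
  generalize f.partner = p at *
  by_contra! hc
  -- a shortest arc between two top points would join neighbours
  have short : ∀ l x, n ≤ x → p x = x + l → l = 0 := by
    intro l
    induction l using Nat.strong_induction_on with
    | _ l ih =>
      intro x hx hp
      by_contra hl
      have hlt : p x < n + n := lt x (by by_contra h; have := out x (by omega); omega)
      have hl1 : l ≠ 1 := by
        rintro rfl
        exact hc (x - n) (by omega) (by rw [show n + (x - n) = x by omega, hp])
      -- The arc at `x + 1` is trapped under the arc from `x` to `x + l`, hence strictly shorter,
      -- and the induction hypothesis excludes it.
      have a1 := inv (x + 1)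
      have a2 := inv x
      have a3 := ne (x + 1) (by omega)
      have a4 := nc x (x + 1) (by omega) (by omega)
      have a5 : x < p (x + 1) := by
        by_contra h
        have b := nc (p (x + 1)) x
        rw [a1] at b
        rcases Nat.lt_or_eq_of_le (Nat.not_lt.1 h) with h' | h'
        · have := b h' (by omega)
          omega
        · rw [h'] at a1; omega
      have a6 : p (x + 1) ≠ p x := fun h => by
        have := congrArg p h; rw [a1, a2] at this; omega
      have := ih (p (x + 1) - (x + 1)) (by omega) (x + 1) (by omega) (by omega)
      omega
  have top_lt : ∀ x, n ≤ x → x < n + n → p x < n := by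
    intro x hx hx'
    by_contra h
    have a1 := inv x
    have a2 := ne x hx'
    rcases Nat.lt_or_ge x (p x) with h' | h'
    · have := short (p x - x) x hx (by omega); omega
    · have := short (x - p x) (p x) (by omega) (by omega); omega
  -- Noncrossing makes `p` strictly decreasing on the top positions.
  have anti : ∀ x y, n ≤ x → x < y → y < n + n → p y < p x := by
    intro x y hx hxy hy
    by_contra h
    have a1 := inv x
    have a2 := inv y
    have a3 := top_lt x hx (by omega)
    have a4 := top_lt y (by omega) hy
    have a5 : p x ≠ p y := fun h => by have := congrArg p h; rw [a1, a2] at this; omega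
    have := nc (p x) (p y)
    omega
  -- A strictly decreasing map from the `n` top positions to `0, …, n - 1` is squeezed between two
  -- bounds that coincide.
  have upper : ∀ j, j < n → p (n + j) + j < n := by
    intro j
    induction j with
    | zero => intro h; have := top_lt n le_rfl (by omega); simpa using this
    | succ j ih =>
      intro h
      have := anti (n + j) (n + (j + 1)) (by omega) (by omega) (by omega)
      have := ih (by omega)
      omega
  have lower : ∀ j, j < n → j ≤ p (n + (n - 1 - j)) := by
    intro j
    induction j with
    | zero => intro h; omega
    | succ j ih =>
      intro h
      have := anti (n + (n - 1 - (j + 1))) (n + (n - 1 - j)) (by omega) (by omega) (by omega)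
      have := ih (by omega)
      omega
  have top_eq : ∀ j, j < n → p (n + j) = n - 1 - j := by
    intro j hj
    have := upper j hj
    have := lower (n - 1 - j) (by omega)
    rw [show n - 1 - (n - 1 - j) = j by omega] at this
    omega
  apply hf
  funext x
  change p x = if x < 2 * n then 2 * n - 1 - x else x
  by_cases h1 : x < n
  · have h := top_eq (n - 1 - x) (by omega)
    rw [show n - 1 - (n - 1 - x) = x by omega] at h
    rw [← h, inv]
    grind
  · by_cases h2 : x < n + n
    · have h := top_eq (x - n) (by omega)
      rw [show n + (x - n) = x by omega] at h
      rw [h]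
      grind
    · rw [out x (by omega), if_neg (by omega)]

end SimpleDiagram

/-! ### Quantum integers -/

theorem q_ne_zero : q ≠ 0 := RatFunc.X_ne_zero

theorem q_pow_ne_one {n : ℕ} (hn : n ≠ 0) : q ^ n ≠ 1 := by
  intro h
  have h' : algebraMap (Polynomial ℂ) (RatFunc ℂ) (Polynomial.X ^ n) =
      algebraMap (Polynomial ℂ) (RatFunc ℂ) 1 := by
    rw [map_pow, RatFunc.algebraMap_X, map_one]
    exact h
  have := congrArg Polynomial.natDegree (RatFunc.algebraMap_injective ℂ h')
  simp [hn] at this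

theorem zpow_sub_zpow_ne_zero {n : ℕ} (hn : n ≠ 0) : q ^ (n : ℤ) - q ^ (-(n : ℤ)) ≠ 0 := by
  intro h
  -- Multiplying `q ^ n = q ^ (-n)` by `q ^ n` would make `q` a root of unity.
  apply q_pow_ne_one (n := 2 * n) (by omega)
  have hq : q ^ n ≠ 0 := pow_ne_zero _ q_ne_zero
  rw [zpow_neg, zpow_natCast, sub_eq_zero] at h
  rw [two_mul, pow_add]
  nth_rw 1 [h]
  exact inv_mul_cancel₀ hq

theorem q_sub_inv_ne_zero : q - q⁻¹ ≠ 0 := by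
  simpa using zpow_sub_zpow_ne_zero one_ne_zero

theorem quantumInt_ne_zero {n : ℕ} (hn : n ≠ 0) : quantumInt n ≠ 0 :=
  div_ne_zero (zpow_sub_zpow_ne_zero hn) q_sub_inv_ne_zero

theorem quantumInt_one : quantumInt 1 = 1 := by
  simpa [quantumInt] using div_self q_sub_inv_ne_zero

theorem loopValue_ne_zero : loopValue ≠ 0 := quantumInt_ne_zero two_ne_zero

/-- This three-term recursion produces the scalar of the partial trace. -/
theorem loopValue_mul_quantumInt (n : ℕ) :
    loopValue * quantumInt (n + 1) = quantumInt (n + 2) + quantumInt n := by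
  have h := q_sub_inv_ne_zero
  have hq := q_ne_zero
  have e : loopValue = q + q⁻¹ := by
    rw [loopValue, quantumInt, div_eq_iff h]
    simp only [zpow_neg, zpow_natCast, ← inv_pow]
    ring
  rw [e, quantumInt, quantumInt, quantumInt, ← add_div, ← mul_div_assoc]
  congr 1
  simp only [zpow_neg, zpow_natCast, ← inv_pow]
  have : q * q⁻¹ = 1 := mul_inv_cancel₀ hq
  -- The mixed terms of the product on the left are `q * q⁻¹` times `q ^ n - q⁻¹ ^ n`.
  linear_combination (q ^ n - q⁻¹ ^ n) * this

/-! ### Linear combinations of diagrams -/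

/-- Reduces multilinear identities between morphisms to the same identities for diagrams. -/
theorem hom_induction {m n : ℕ} {motive : Hom m n → Prop} (x : Hom m n)
    (zero : motive 0) (mk : ∀ f, motive (mk f)) (add : ∀ x y, motive x → motive y → motive (x + y))
    (smul : ∀ (c : 𝔽) x, motive x → motive (c • x)) : motive x := by
  obtain ⟨v, rfl⟩ := (dEquiv m n).mkQ_surjective x
  induction v using Finsupp.induction_linear with
  | zero => rwa [map_zero]
  | add x y hx hy => rw [map_add]; exact add _ _ hx hy
  | single f c =>
    have := smul c _ (mk f)
    rwa [TemperleyLieb.mk, ← map_smul, Finsupp.smul_single_one] at this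

theorem comp_add {m n k : ℕ} (g : Hom n k) (f f' : Hom m n) :
    comp g (f + f') = comp g f + comp g f' := map_add _ _ _

theorem comp_sub {m n k : ℕ} (g : Hom n k) (f f' : Hom m n) :
    comp g (f - f') = comp g f - comp g f' := map_sub _ _ _

theorem comp_smul {m n k : ℕ} (g : Hom n k) (c : 𝔽) (f : Hom m n) :
    comp g (c • f) = c • comp g f := map_smul _ _ _

@[simp]
theorem comp_zero {m n k : ℕ} (g : Hom n k) : comp g (0 : Hom m n) = 0 := map_zero _

theorem add_comp {m n k : ℕ} (g g' : Hom n k) (f : Hom m n) :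
    comp (g + g') f = comp g f + comp g' f := by
  simp [comp]

theorem sub_comp {m n k : ℕ} (g g' : Hom n k) (f : Hom m n) :
    comp (g - g') f = comp g f - comp g' f := by
  simp [comp]

theorem smul_comp {m n k : ℕ} (c : 𝔽) (g : Hom n k) (f : Hom m n) :
    comp (c • g) f = c • comp g f := by
  simp [comp]

@[simp]
theorem zero_comp {m n k : ℕ} (f : Hom m n) : comp (0 : Hom n k) f = 0 := by
  simp [comp]

theorem comp_assoc {m n k l : ℕ} (h : Hom k l) (g : Hom n k) (f : Hom m n) :
    comp (comp h g) f = comp h (comp g f) := by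
  induction h using hom_induction with
  | zero => simp
  | mk h =>
    induction g using hom_induction with
    | zero => simp
    | mk g =>
      induction f using hom_induction with
      | zero => simp
      | mk f => simp only [comp_mk, SimpleDiagram.comp_assoc]
      | add x y hx hy => simp only [comp_add, hx, hy]
      | smul c x hx => simp only [comp_smul, hx]
    | add x y hx hy => simp only [comp_add, add_comp, hx, hy]
    | smul c x hx => simp only [comp_smul, smul_comp, hx]
  | add x y hx hy => simp only [add_comp, hx, hy]
  | smul c x hx => simp only [smul_comp, hx]

theorem id_comp {m n : ℕ} (f : Hom m n) : comp (id n) f = f := by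
  induction f using hom_induction with
  | zero => simp
  | mk f => rw [id, comp_mk, SimpleDiagram.id_comp]
  | add x y hx hy => rw [comp_add, hx, hy]
  | smul c x hx => rw [comp_smul, hx]

theorem comp_id {m n : ℕ} (f : Hom m n) : comp f (id m) = f := by
  induction f using hom_induction with
  | zero => simp
  | mk f => rw [id, comp_mk, SimpleDiagram.comp_id]
  | add x y hx hy => rw [add_comp, hx, hy]
  | smul c x hx => rw [smul_comp, hx]

/-- The functor `- ⊗ id_1` on morphisms. -/
noncomputable def tensorOne {m n : ℕ} (f : Hom m n) : Hom (m + 1) (n + 1) := tensor f (id 1)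

theorem tensorOne_mk {m n : ℕ} (f : SimpleDiagram m n) :
    tensorOne (mk f) = mk (f.tensor (SimpleDiagram.id 1)) := tensor_mk _ _

theorem tensorOne_add {m n : ℕ} (f g : Hom m n) :
    tensorOne (f + g) = tensorOne f + tensorOne g := by
  simp [tensorOne, tensor]

theorem tensorOne_sub {m n : ℕ} (f g : Hom m n) :
    tensorOne (f - g) = tensorOne f - tensorOne g := by
  simp [tensorOne, tensor]

theorem tensorOne_smul {m n : ℕ} (c : 𝔽) (f : Hom m n) :
    tensorOne (c • f) = c • tensorOne f := by
  simp [tensorOne, tensor]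

@[simp]
theorem tensorOne_zero {m n : ℕ} : tensorOne (0 : Hom m n) = 0 := by
  simp [tensorOne, tensor]

theorem tensorOne_id (n : ℕ) : tensorOne (id n) = id (n + 1) := by
  rw [id, tensorOne_mk, SimpleDiagram.id_tensor_id, id]

theorem tensorOne_comp {m n k : ℕ} (g : Hom n k) (f : Hom m n) :
    tensorOne (comp g f) = comp (tensorOne g) (tensorOne f) := by
  induction g using hom_induction with
  | zero => simp
  | mk g =>
    induction f using hom_induction with
    | zero => simp
    | mk f => simp only [comp_mk, tensorOne_mk, SimpleDiagram.tensor_comp_tensor]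
    | add x y hx hy => simp only [comp_add, tensorOne_add, hx, hy]
    | smul c x hx => simp only [comp_smul, tensorOne_smul, hx]
  | add x y hx hy => simp only [add_comp, tensorOne_add, hx, hy]
  | smul c x hx => simp only [smul_comp, tensorOne_smul, hx]

/-- Reflection in the horizontal middle line, extended linearly. -/
noncomputable def reflect (m n : ℕ) : Hom m n →ₗ[𝔽] Hom n m :=
  lift (fun f => mk f.reflect) fun f => by rw [← mk_addLoop]; rfl

theorem reflect_mk {m n : ℕ} (f : SimpleDiagram m n) : reflect m n (mk f) = mk f.reflect :=
  lift_mk _ _ _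

theorem reflect_reflect {m n : ℕ} (f : Hom m n) : reflect n m (reflect m n f) = f := by
  induction f using hom_induction with
  | zero => simp
  | mk f => rw [reflect_mk, reflect_mk, SimpleDiagram.reflect_reflect]
  | add x y hx hy => rw [map_add, map_add, hx, hy]
  | smul c x hx => rw [map_smul, map_smul, hx]

theorem reflect_id (n : ℕ) : reflect n n (id n) = id n := by
  rw [id, reflect_mk, SimpleDiagram.reflect_id]

theorem reflect_comp {m n k : ℕ} (g : Hom n k) (f : Hom m n) :
    reflect m k (comp g f) = comp (reflect m n f) (reflect n k g) := by
  induction g using hom_induction with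
  | zero => simp
  | mk g =>
    induction f using hom_induction with
    | zero => simp
    | mk f => simp only [comp_mk, reflect_mk, SimpleDiagram.reflect_comp]
    | add x y hx hy => simp only [comp_add, add_comp, map_add, hx, hy]
    | smul c x hx => simp only [comp_smul, smul_comp, map_smul, hx]
  | add x y hx hy => simp only [comp_add, add_comp, map_add, hx, hy]
  | smul c x hx => simp only [comp_smul, smul_comp, map_smul, hx]

theorem reflect_tensorOne {m n : ℕ} (f : Hom m n) :
    reflect (m + 1) (n + 1) (tensorOne f) = tensorOne (reflect m n f) := by
  induction f using hom_induction with
  | zero => simp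
  | mk f => simp only [tensorOne_mk, reflect_mk, SimpleDiagram.reflect_tensor_id]
  | add x y hx hy => simp only [tensorOne_add, map_add, hx, hy]
  | smul c x hx => simp only [tensorOne_smul, map_smul, hx]

/-- The morphism of `SimpleDiagram.cupAt`. -/
noncomputable def cupAt (n i : ℕ) (h : i ≤ n) : Hom n (n + 2) := mk (SimpleDiagram.cupAt n i h)

/-- The morphism of `SimpleDiagram.capAt`. -/
noncomputable def capAt (n i : ℕ) (h : i ≤ n) : Hom (n + 2) n := mk (SimpleDiagram.capAt n i h)

theorem reflect_cupAt (n i : ℕ) (h : i ≤ n) : reflect _ _ (cupAt n i h) = capAt n i h :=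
  reflect_mk _

theorem reflect_capAt (n i : ℕ) (h : i ≤ n) : reflect _ _ (capAt n i h) = cupAt n i h := by
  rw [← reflect_cupAt, reflect_reflect]

theorem cap_comp_cup (n i : ℕ) (h : i ≤ n) :
    comp (capAt n i h) (cupAt n i h) = loopValue • id n := by
  rw [capAt, cupAt, comp_mk, SimpleDiagram.cap_comp_cup, mk_addLoop, id]

theorem cap_comp_cup_succ (n i : ℕ) (h : i + 1 ≤ n) :
    comp (capAt n i (by omega)) (cupAt n (i + 1) h) = id n := by
  rw [capAt, cupAt, comp_mk, SimpleDiagram.cap_comp_cup_succ, id]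

theorem cap_succ_comp_cup (n i : ℕ) (h : i + 1 ≤ n) :
    comp (capAt n (i + 1) h) (cupAt n i (by omega)) = id n := by
  rw [capAt, cupAt, comp_mk, SimpleDiagram.cap_succ_comp_cup, id]

theorem tensorOne_capAt {n i : ℕ} (h : i ≤ n) :
    tensorOne (capAt n i h) = capAt (n + 1) i (by omega) := by
  rw [capAt, tensorOne_mk, SimpleDiagram.capAt_tensor, capAt]

theorem tensorOne_cupAt {n i : ℕ} (h : i ≤ n) :
    tensorOne (cupAt n i h) = cupAt (n + 1) i (by omega) := by
  rw [cupAt, tensorOne_mk, SimpleDiagram.cupAt_tensor, cupAt]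

/-- The two strands to the right of `f` closed by the cap can be pulled down past `f`. -/
theorem cap_comp_tensorOne_tensorOne {m n : ℕ} (f : Hom m n) :
    comp (capAt n n le_rfl) (tensorOne (tensorOne f)) = comp f (capAt m m le_rfl) := by
  induction f using hom_induction with
  | zero => simp
  | mk f =>
    rw [capAt, capAt, tensorOne_mk, tensorOne_mk, comp_mk, comp_mk,
      SimpleDiagram.cap_comp_tensor_tensor]
  | add x y hx hy => simp only [tensorOne_add, comp_add, add_comp, hx, hy]
  | smul c x hx => simp only [tensorOne_smul, comp_smul, smul_comp, hx]

theorem tensorOne_tensorOne_comp_cup {m n : ℕ} (f : Hom m n) :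
    comp (tensorOne (tensorOne f)) (cupAt m m le_rfl) = comp (cupAt n n le_rfl) f := by
  have h := congrArg (reflect _ _) (cap_comp_tensorOne_tensorOne (reflect m n f))
  rwa [reflect_comp, reflect_comp, reflect_tensorOne, reflect_tensorOne, reflect_reflect,
    reflect_capAt, reflect_capAt] at h

/-! ### Non-identity diagrams -/

theorem comp_cap_mem_nonIdentitySpan {n i : ℕ} (h : i ≤ n) (x : Hom n (n + 2)) :
    comp x (capAt n i h) ∈ nonIdentitySpan (n + 2) := by
  induction x using hom_induction with
  | zero => simp
  | mk f =>
    rw [capAt, comp_mk]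
    exact Submodule.subset_span ⟨_, SimpleDiagram.comp_cap_partner_ne_id h f, rfl⟩
  | add x y hx hy => rw [add_comp]; exact add_mem hx hy
  | smul c x hx => rw [smul_comp]; exact Submodule.smul_mem _ _ hx

theorem cup_comp_mem_nonIdentitySpan {n i : ℕ} (h : i ≤ n) (x : Hom (n + 2) n) :
    comp (cupAt n i h) x ∈ nonIdentitySpan (n + 2) := by
  induction x using hom_induction with
  | zero => simp
  | mk f =>
    rw [cupAt, comp_mk]
    exact Submodule.subset_span ⟨_, SimpleDiagram.cup_comp_partner_ne_id h f, rfl⟩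
  | add x y hx hy => rw [comp_add]; exact add_mem hx hy
  | smul c x hx => rw [comp_smul]; exact Submodule.smul_mem _ _ hx

theorem eq_cup_comp_of_ne_id {n : ℕ} (f : SimpleDiagram (n + 2) (n + 2))
    (hf : f.partner ≠ (SimpleDiagram.id (n + 2)).partner) :
    ∃ (i : ℕ) (h : i ≤ n) (x : Hom (n + 2) n), mk f = comp (cupAt n i h) x := by
  obtain ⟨i, hi, hp⟩ := f.exists_top_arc hf
  have h : i ≤ n := by omega
  -- Capping the arc at the top of `f` closes a loop; the factor `d⁻¹` compensates for it.
  refine ⟨i, h, loopValue⁻¹ • comp (capAt n i h) (mk f), ?_⟩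
  rw [comp_smul, capAt, comp_mk, cupAt, comp_mk, SimpleDiagram.cup_comp_cap_comp h f hp,
    mk_addLoop, inv_smul_smul₀ loopValue_ne_zero]

theorem SimpleDiagram.reflect_ne_id {n : ℕ} {f : SimpleDiagram n n}
    (hf : f.partner ≠ (id n).partner) : f.reflect.partner ≠ (id n).partner := by
  intro h
  apply hf
  rw [← reflect_reflect f, reflect_partner, h, ← reflect_partner, reflect_id]

theorem eq_comp_cap_of_ne_id {n : ℕ} (f : SimpleDiagram (n + 2) (n + 2))
    (hf : f.partner ≠ (SimpleDiagram.id (n + 2)).partner) :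
    ∃ (i : ℕ) (h : i ≤ n) (x : Hom n (n + 2)), mk f = comp x (capAt n i h) := by
  obtain ⟨i, h, x, hx⟩ := eq_cup_comp_of_ne_id f.reflect (SimpleDiagram.reflect_ne_id hf)
  refine ⟨i, h, reflect _ _ x, ?_⟩
  rw [← reflect_cupAt, ← reflect_comp, ← hx, reflect_mk, SimpleDiagram.reflect_reflect]

/-- The only diagram on fewer than two points is the identity. -/
theorem nonIdentitySpan_eq_bot {n : ℕ} (hn : n < 2) : nonIdentitySpan n = ⊥ := by
  rw [nonIdentitySpan, Submodule.span_eq_bot]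
  rintro _ ⟨f, hf, -⟩
  obtain ⟨i, hi, -⟩ := f.exists_top_arc hf
  omega

/-- A non-identity diagram can be written with a cap at its bottom, and composing on top leaves that
cap in place. -/
theorem comp_mem_nonIdentitySpan {n : ℕ} (x : Hom n n) {y : Hom n n}
    (hy : y ∈ nonIdentitySpan n) : comp x y ∈ nonIdentitySpan n := by
  obtain _ | _ | n := n
  · rw [nonIdentitySpan_eq_bot (by omega), Submodule.mem_bot] at *
    rw [hy, comp_zero]
  · rw [nonIdentitySpan_eq_bot (by omega), Submodule.mem_bot] at *
    rw [hy, comp_zero]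
  · induction hy using Submodule.span_induction with
    | mem y hy =>
      obtain ⟨f, hf, rfl⟩ := hy
      obtain ⟨i, h, z, hz⟩ := eq_comp_cap_of_ne_id f hf
      rw [hz, ← comp_assoc]
      exact comp_cap_mem_nonIdentitySpan h _
    | zero => simp
    | add y z _ _ hy hz => rw [comp_add]; exact add_mem hy hz
    | smul c y _ hy => rw [comp_smul]; exact Submodule.smul_mem _ _ hy

theorem tensorOne_mem_nonIdentitySpan {n : ℕ} {x : Hom n n} (hx : x ∈ nonIdentitySpan n) :
    tensorOne x ∈ nonIdentitySpan (n + 1) := by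
  induction hx using Submodule.span_induction with
  | mem x hx =>
    obtain ⟨f, hf, rfl⟩ := hx
    rw [tensorOne_mk]
    refine Submodule.subset_span ⟨_, fun h => hf (funext fun x => ?_), rfl⟩
    -- The arcs of `f` reappear in `f ⊗ id_1` shifted by one, so they can be recovered from it.
    by_cases hx : x < n + n
    · have e : (f.tensor (SimpleDiagram.id 1)).partner (x + 1) = f.partner x + 1 :=
        wrap_succ f.partner hx
      have e' : ((SimpleDiagram.id n).tensor (SimpleDiagram.id 1)).partner (x + 1) =
        (SimpleDiagram.id n).partner x + 1 := wrap_succ _ hx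
      rw [h, ← SimpleDiagram.id_tensor_id, e'] at e
      omega
    · rw [f.isNCMatching.outside x (by omega), (SimpleDiagram.id n).isNCMatching.outside x (by omega)]
  | zero => simp
  | add y z _ _ hy hz => rw [tensorOne_add]; exact add_mem hy hz
  | smul c y _ hy => rw [tensorOne_smul]; exact Submodule.smul_mem _ _ hy

/-- An element annihilated by all caps is annihilated by all non-identity diagrams. -/
theorem comp_eq_zero_of_cap {n : ℕ} {p x : Hom n n}
    (hp : ∀ (i : ℕ) (hi : 1 ≤ i) (hn : i < n), comp (cap n i hi hn) p = 0)
    (hx : x ∈ nonIdentitySpan n) : comp x p = 0 := by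
  obtain _ | _ | n := n
  · rw [nonIdentitySpan_eq_bot (by omega), Submodule.mem_bot] at hx
    rw [hx, zero_comp]
  · rw [nonIdentitySpan_eq_bot (by omega), Submodule.mem_bot] at hx
    rw [hx, zero_comp]
  · induction hx using Submodule.span_induction with
    | mem y hy =>
      obtain ⟨f, hf, rfl⟩ := hy
      obtain ⟨i, h, z, hz⟩ := eq_comp_cap_of_ne_id f hf
      have e : comp (capAt n i h) p = 0 := hp (i + 1) (by omega) (by omega)
      rw [hz, comp_assoc, e, comp_zero]
    | zero => simp
    | add y z _ _ hy hz => rw [add_comp, hy, hz, add_zero]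
    | smul c y _ hy => rw [smul_comp, hy, smul_zero]

/-- An element annihilated by all cups is annihilated by all non-identity diagrams. -/
theorem comp_eq_zero_of_cup {n : ℕ} {p x : Hom n n}
    (hp : ∀ (i : ℕ) (hi : 1 ≤ i) (hn : i < n), comp p (cup n i hi hn) = 0)
    (hx : x ∈ nonIdentitySpan n) : comp p x = 0 := by
  obtain _ | _ | n := n
  · rw [nonIdentitySpan_eq_bot (by omega), Submodule.mem_bot] at hx
    rw [hx, comp_zero]
  · rw [nonIdentitySpan_eq_bot (by omega), Submodule.mem_bot] at hx
    rw [hx, comp_zero]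
  · induction hx using Submodule.span_induction with
    | mem y hy =>
      obtain ⟨f, hf, rfl⟩ := hy
      obtain ⟨i, h, z, hz⟩ := eq_cup_comp_of_ne_id f hf
      have e : comp p (cupAt n i h) = 0 := hp (i + 1) (by omega) (by omega)
      rw [hz, ← comp_assoc, e, zero_comp]
    | zero => simp
    | add y z _ _ hy hz => rw [comp_add, hy, hz, add_zero]
    | smul c y _ hy => rw [comp_smul, hy, smul_zero]

open Classical in
/-- The coefficient of the identity diagram. -/
noncomputable def idCoeff (n : ℕ) : Hom n n →ₗ[𝔽] 𝔽 :=
  lift (fun f => if f.partner = (SimpleDiagram.id n).partner then loopValue ^ f.loops else 0)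
    fun f => by
      simp only [SimpleDiagram.addLoop, smul_eq_mul, pow_succ']
      split_ifs <;> simp

theorem idCoeff_id (n : ℕ) : idCoeff n (id n) = 1 := by
  rw [id, idCoeff, lift_mk, if_pos rfl]
  exact pow_zero _

theorem idCoeff_eq_zero {n : ℕ} {x : Hom n n} (hx : x ∈ nonIdentitySpan n) : idCoeff n x = 0 := by
  have h : nonIdentitySpan n ≤ LinearMap.ker (idCoeff n) := by
    rw [nonIdentitySpan, Submodule.span_le]
    rintro _ ⟨f, hf, rfl⟩
    rw [SetLike.mem_coe, LinearMap.mem_ker, idCoeff, lift_mk, if_neg hf]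
  exact h hx

/-! ### The Jones-Wenzl elements -/

theorem jonesWenzl_succ_succ (n : ℕ) :
    jonesWenzl (n + 2) = tensorOne (jonesWenzl (n + 1)) -
      (quantumInt (n + 1) / quantumInt (n + 2)) •
        comp (tensorOne (jonesWenzl (n + 1))) (comp (cupAt n n le_rfl)
          (comp (capAt n n le_rfl) (tensorOne (jonesWenzl (n + 1))))) := by
  rw [jonesWenzl]
  rfl

/-- Reflection exchanges `∪_n` with `∩_n` and reverses products, so the correction term of the
recursion is a palindrome. -/
theorem reflect_jonesWenzl (n : ℕ) : reflect n n (jonesWenzl n) = jonesWenzl n := by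
  induction n using Nat.strong_induction_on with
  | _ n ih =>
    obtain _ | _ | n := n
    · exact reflect_id 0
    · exact reflect_id 1
    · have h := ih (n + 1) (by omega)
      rw [jonesWenzl_succ_succ, map_sub, map_smul, reflect_comp, reflect_comp, reflect_comp,
        reflect_cupAt, reflect_capAt, reflect_tensorOne, h, comp_assoc, comp_assoc]

theorem jonesWenzl_eq_id_add (n : ℕ) : ∃ m ∈ nonIdentitySpan n, jonesWenzl n = id n + m := by
  induction n using Nat.strong_induction_on with
  | _ n ih =>
    obtain _ | _ | n := n
    · exact ⟨0, zero_mem _, (add_zero _).symm⟩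
    · exact ⟨0, zero_mem _, (add_zero _).symm⟩
    · obtain ⟨m, hm, e⟩ := ih (n + 1) (by omega)
      have h := tensorOne_mem_nonIdentitySpan hm
      have h' := Submodule.smul_mem _ (quantumInt (n + 1) / quantumInt (n + 2))
        (comp_mem_nonIdentitySpan (tensorOne (jonesWenzl (n + 1))) (cup_comp_mem_nonIdentitySpan
          le_rfl (comp (capAt n n le_rfl) (tensorOne (jonesWenzl (n + 1))))))
      refine ⟨_, sub_mem h h', ?_⟩
      rw [← add_sub_assoc, ← tensorOne_id, ← tensorOne_add, ← e, jonesWenzl_succ_succ]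

/-- Write the left factor as `id + m`; then `m` annihilates the right factor. -/
theorem idem_of_cap {n : ℕ} (h : ∀ (i : ℕ) (hi : 1 ≤ i) (hn : i < n),
    comp (cap n i hi hn) (jonesWenzl n) = 0) :
    comp (jonesWenzl n) (jonesWenzl n) = jonesWenzl n := by
  obtain ⟨m, hm, e⟩ := jonesWenzl_eq_id_add n
  nth_rw 1 [e]
  rw [add_comp, id_comp, comp_eq_zero_of_cap h hm, add_zero]

/-- Both terms of the recursion have `p_n ⊗ id_1` as their leftmost factor, which absorbs another
copy. -/
theorem tensorOne_comp_jonesWenzl {n : ℕ}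
    (hn : comp (jonesWenzl n) (jonesWenzl n) = jonesWenzl n) :
    comp (tensorOne (jonesWenzl n)) (jonesWenzl (n + 1)) = jonesWenzl (n + 1) := by
  obtain _ | n := n
  · rw [show jonesWenzl 0 = id 0 by rw [jonesWenzl], tensorOne_id, id_comp]
  · rw [jonesWenzl_succ_succ, comp_sub, comp_smul, ← comp_assoc, ← tensorOne_comp, hn]

/-- Expanding by the recursion, the first term closes a free loop and gives `d` times the smaller
idempotent. In the correction term the cups and caps cancel by the two snake identities, leaving its
square. -/
theorem partialTrace_jonesWenzl {n : ℕ}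
    (hn : comp (jonesWenzl n) (jonesWenzl n) = jonesWenzl n) :
    comp (capAt n n le_rfl) (comp (tensorOne (jonesWenzl (n + 1))) (cupAt n n le_rfl)) =
      (quantumInt (n + 2) / quantumInt (n + 1)) • jonesWenzl n := by
  obtain _ | n := n
  · rw [show jonesWenzl 0 = id 0 by rw [jonesWenzl],
      show jonesWenzl (0 + 1) = id 1 by rw [jonesWenzl], tensorOne_id, id_comp, cap_comp_cup,
      quantumInt_one, div_one, loopValue]
  -- The smaller idempotent, carrying two free strands on its right, slides out below the last cap;
  -- likewise for the last cup.
  · have e1 : ∀ x : Hom (n + 1) (n + 3), comp (capAt (n + 1) (n + 1) le_rfl)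
        (comp (tensorOne (tensorOne (jonesWenzl (n + 1)))) x) =
          comp (jonesWenzl (n + 1)) (comp (capAt (n + 1) (n + 1) le_rfl) x) := fun x => by
      rw [← comp_assoc, cap_comp_tensorOne_tensorOne, comp_assoc]
    rw [jonesWenzl_succ_succ, tensorOne_sub, tensorOne_smul, tensorOne_comp, tensorOne_comp,
      tensorOne_comp, tensorOne_cupAt, tensorOne_capAt, sub_comp, smul_comp, comp_sub, comp_smul]
    simp only [comp_assoc, tensorOne_tensorOne_comp_cup, e1]
    simp only [← comp_assoc (capAt _ _ _), cap_comp_cup, cap_comp_cup_succ, cap_succ_comp_cup,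
      id_comp, smul_comp, hn]
    -- What remains is `d - [n+1]/[n+2] = [n+3]/[n+2]`.
    rw [← sub_smul]
    congr 1
    have h1 := quantumInt_ne_zero (show n + 1 + 1 ≠ 0 by omega)
    have h2 := loopValue_mul_quantumInt (n + 1)
    rw [eq_div_iff h1, sub_mul, h2]
    rw [show n + 2 = n + 1 + 1 by ring, div_mul_cancel₀ _ h1]
    ring

/-- Strong induction, since the step to `n + 2` uses both the absorption property and the partial
trace, which rest on the idempotence of `p_n`. -/
theorem cap_comp_jonesWenzl (n : ℕ) : ∀ (i : ℕ) (hi : 1 ≤ i) (hn : i < n),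
    comp (cap n i hi hn) (jonesWenzl n) = 0 := by
  induction n using Nat.strong_induction_on with
  | _ n ih =>
    intro i hi hn
    obtain _ | _ | n := n
    · omega
    · omega
    obtain ⟨i, rfl⟩ : ∃ j, i = j + 1 := ⟨i - 1, by omega⟩
    change comp (capAt n i (by omega)) (jonesWenzl (n + 2)) = 0
    have idem : comp (jonesWenzl n) (jonesWenzl n) = jonesWenzl n :=
      idem_of_cap (ih n (by omega))
    rw [jonesWenzl_succ_succ, comp_sub, comp_smul]
    obtain rfl | hin := eq_or_lt_of_le (show i ≤ n by omega)
    -- Last cap: the partial trace turns the correction term into `p_i ∩ (p_{i+1} ⊗ id_1)`. Here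
    -- `p_i` slides up through the cap and is absorbed by `p_{i+1}`, so this cancels the first term.
    · have h1 := quantumInt_ne_zero (show i + 1 ≠ 0 by omega)
      have h2 := quantumInt_ne_zero (show i + 2 ≠ 0 by omega)
      rw [← comp_assoc (tensorOne _) (cupAt _ _ _), ← comp_assoc (capAt _ _ _),
        partialTrace_jonesWenzl idem, smul_comp, smul_smul, ← comp_assoc,
        ← cap_comp_tensorOne_tensorOne, comp_assoc, ← tensorOne_comp,
        tensorOne_comp_jonesWenzl idem, div_mul_div_cancel₀ h2, div_self h1, one_smul, sub_self]
    -- Any other cap avoids the added strand and already kills the preceding idempotent tensored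
    -- with `id_1`, the upper factor of both terms.
    · obtain ⟨n, rfl⟩ : ∃ k, n = k + 1 := ⟨n - 1, by omega⟩
      have h : comp (capAt n i (by omega)) (jonesWenzl (n + 2)) = 0 :=
        ih (n + 2) (by omega) (i + 1) (by omega) (by omega)
      have h' : comp (capAt (n + 1) i (by omega)) (tensorOne (jonesWenzl (n + 2))) = 0 := by
        rw [← tensorOne_capAt, ← tensorOne_comp, h, tensorOne_zero]
        omega
      rw [← comp_assoc, h', zero_comp, smul_zero, sub_zero]

theorem jonesWenzl_comp_cup (n i : ℕ) (hi : 1 ≤ i) (hn : i < n) :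
    comp (jonesWenzl n) (cup n i hi hn) = 0 := by
  have h := congrArg (reflect _ _) (cap_comp_jonesWenzl n i hi hn)
  rwa [reflect_comp, reflect_jonesWenzl, cap, SimpleDiagram.cap, ← reflect_mk, reflect_reflect,
    map_zero] at h

theorem isJonesWenzl_jonesWenzl (n : ℕ) : IsJonesWenzl n (jonesWenzl n) where
  ne_zero h := by
    obtain ⟨m, hm, e⟩ := jonesWenzl_eq_id_add n
    have := congrArg (idCoeff n) e
    simp [h, idCoeff_id, idCoeff_eq_zero hm] at this
  eq_id_add := jonesWenzl_eq_id_add n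
  cap_comp := cap_comp_jonesWenzl n
  comp_cup := jonesWenzl_comp_cup n
  idem := idem_of_cap (cap_comp_jonesWenzl n)

/-- Evaluate `p p'` twice: the non-identity part of `p` is killed by `p'` through caps, that of `p'`
by `p` through cups. -/
theorem IsJonesWenzl.unique {n : ℕ} {p p' : Hom n n} (h : IsJonesWenzl n p)
    (h' : IsJonesWenzl n p') : p = p' := by
  obtain ⟨m, hm, e⟩ := h.eq_id_add
  obtain ⟨m', hm', e'⟩ := h'.eq_id_add
  have h1 : comp p p' = p' := by
    rw [e, add_comp, id_comp, comp_eq_zero_of_cap h'.cap_comp hm, add_zero]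
  have h2 : comp p p' = p := by
    rw [e', comp_add, comp_id, comp_eq_zero_of_cup h.comp_cup hm', add_zero]
  rw [← h2, h1]

end TemperleyLieb

/-- For every `n` the denominator `[n + 1]` of the recursion does not vanish, and the recursively
defined `p_n` is the unique endomorphism of `n` with the Jones-Wenzl properties. -/
theorem mainTheorem1 (n : ℕ) :
    TemperleyLieb.quantumInt (n + 1) ≠ 0 ∧
      TemperleyLieb.IsJonesWenzl n (TemperleyLieb.jonesWenzl n) ∧
      ∀ p : TemperleyLieb.Hom n n,
        TemperleyLieb.IsJonesWenzl n p → p = TemperleyLieb.jonesWenzl n :=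
  ⟨TemperleyLieb.quantumInt_ne_zero n.succ_ne_zero, TemperleyLieb.isJonesWenzl_jonesWenzl n,
    fun _ hp => hp.unique (TemperleyLieb.isJonesWenzl_jonesWenzl n)⟩
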